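/- Let $k\ge 1$ and let $e_1,\dots,e_k$ be the coordinate vectors of $\mathbb{R}^k$. Let $n\ge 1$ and let $X_1,\dots,X_n$ be identically distributed, 1-dependent random vectors with values in $\{0,e_1,\dots,e_k\}$ almost surely; 1-dependence means that $\sigma(X_1,\dots,X_l)$ and $\sigma(X_t,\dots,X_s)$ are independent whenever $t-l>1$. Put $p_r=P(X_1=e_r)\in(0,1)$, $p_{rj}=P(X_1=e_r,X_2=e_j)$, $p_{rjm}=P(X_1=e_r,X_2=e_j,X_3=e_m)$, and assume that all pairs $(X_i,X_{i+1})$ of consecutive vectors have the same distribution and all triples $(X_i,X_{i+1},X_{i+2})$ of consecutive vectors have the same distribution, so that these probabilities do not depend on the position (if $n<3$, the missing vectors among $X_2,X_3$ in these formulas are arbitrary further random vectors on the same probability space). Assume that $$\max_{1\le j\le k}p_j\le \frac1{144k},\qquad \sum_{m=1}^k(p_{mj}+p_{jm})\le\frac{p_j}{5},\quad j=1,\dots,k.$$ Let $F_n$ be the distribution of $X_1+\dots+X_n$ and let $G$ be the finite signed (signed compound Poisson) measure on $\mathbb{Z}^k$ with Fourier transform $$\sum_{m\in\mathbb{Z}^k}G\{m\}e^{\mathrm{i}(m,t)}=\exp\Big\{n\sum_{j=1}^kp_j(e^{\mathrm{i}t_j}-1)-\frac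 n2\Big(\sum_{j=1}^kp_j(e^{\mathrm{i}t_j}-1)\Big)^2+(n-1)\sum_{j,m=1}^k(p_{jm}-p_jp_m)(e^{\mathrm{i}t_j}-1)(e^{\mathrm{i}t_m}-1)\Big\}.$$ Let $\gamma_j=\max(1,\sqrt{np_j})$ and $$\varepsilon_2=\sum_{r,j,m=1}^k\frac{p_{rjm}+p_{rj}p_m+p_rp_jp_m}{\gamma_r\gamma_j\gamma_m}.$$ For a finite signed measure $M$ on $\mathbb{Z}^k$ let $\|M\|_\infty=\sup_m|M\{m\}|$ and $\|M\|_\alpha=\big(\sum_m|M\{m\}|^\alpha\big)^{1/\alpha}$. Then there are a constant $C(k)$ depending only on $k$ and, for every real $\alpha\ge2$, a constant $C(k,\alpha)$ depending only on $k$ and $\alpha$, such that $$\|F_n-G\|_\infty\le C(k)\,n\,\varepsilon_2\prod_{j=1}^k\gamma_j^{-1},\qquad \|F_n-G\|_\alpha\le C(k,\alpha)\,n\,\varepsilon_2\prod_{j=1}^k\gamma_j^{-(\alpha-1)/\alpha}\quad(\alpha\ge2).$$ -/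

import Mathlib

open MeasureTheory ProbabilityTheory
open scoped ENNReal

noncomputable section

/-! Measures on the lattice `ℤ^k` are given by their point masses `M : (Fin k → ℤ) → ℝ`,
`M m = M{m}`. -/

/-- `M` is (the family of point masses of) a finite signed measure on `ℤ^k` whose Fourier
transform is `φ`, i.e. `∑_m M{m} exp (i (m, t)) = φ t` for all `t`. -/
def HasFourierTransform {k : ℕ} (M : (Fin k → ℤ) → ℝ) (φ : (Fin k → ℝ) → ℂ) : Prop :=
  Summable (fun m => |M m|) ∧
    ∀ t : Fin k → ℝ,
      HasSum (fun m => (M m : ℂ) * Complex.exp (Complex.I * ((∑ j, (m j : ℝ) * t j : ℝ) : ℂ))) (φ t)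

/-- The norm `‖M‖_α`, `α ∈ [1, ∞]`, of a finite signed measure on `ℤ^k`. -/
def latticeNorm {k : ℕ} (α : ℝ≥0∞) (M : (Fin k → ℤ) → ℝ) : ℝ≥0∞ :=
  eLpNorm M α Measure.count

theorem latticeNorm_top {k : ℕ} (M : (Fin k → ℤ) → ℝ) :
    latticeNorm ∞ M = ⨆ m, ENNReal.ofReal |M m| := by
  simp [latticeNorm, ← Real.norm_eq_abs, ofReal_norm]

theorem latticeNorm_ofReal {k : ℕ} (α : ℝ) (hα : 0 < α) (M : (Fin k → ℤ) → ℝ) :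
    latticeNorm (ENNReal.ofReal α) M = (∑' m, ENNReal.ofReal (|M m|) ^ α) ^ (1 / α) := by
  have h0 : ENNReal.ofReal α ≠ 0 := by simpa using hα
  rw [latticeNorm, eLpNorm_eq_lintegral_rpow_enorm_toReal h0 ENNReal.ofReal_ne_top,
    ENNReal.toReal_ofReal hα.le, lintegral_count]
  simp [← Real.norm_eq_abs, ofReal_norm]

section Probabilities

variable {Ω : Type*} [MeasurableSpace Ω] {k : ℕ}

/-- The `r`-th coordinate vector of `ℤ^k`. -/
def coordVec {k : ℕ} (r : Fin k) : Fin k → ℤ := Pi.single r 1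

/-- `p_r = P(X₁ = e_r)`. The vectors `X₁, X₂, …` are `X 0, X 1, …`. -/
def prob1 (μ : Measure Ω) (X : ℕ → Ω → Fin k → ℤ) (r : Fin k) : ℝ :=
  μ.real {ω | X 0 ω = coordVec r}

/-- `p_{rj} = P(X₁ = e_r, X₂ = e_j)`. -/
def prob2 (μ : Measure Ω) (X : ℕ → Ω → Fin k → ℤ) (r j : Fin k) : ℝ :=
  μ.real {ω | X 0 ω = coordVec r ∧ X 1 ω = coordVec j}

/-- `p_{rjm} = P(X₁ = e_r, X₂ = e_j, X₃ = e_m)`. -/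
def prob3 (μ : Measure Ω) (X : ℕ → Ω → Fin k → ℤ) (r j m : Fin k) : ℝ :=
  μ.real {ω | X 0 ω = coordVec r ∧ X 1 ω = coordVec j ∧ X 2 ω = coordVec m}

/-- The sigma-algebra generated by `X_s, …, X_t`. -/
@[reducible] def sigmaGen (X : ℕ → Ω → Fin k → ℤ) (s t : ℕ) : MeasurableSpace Ω :=
  ⨆ i ∈ Set.Icc s t, MeasurableSpace.comap (X i) inferInstance

/-- 1-dependence of the first `n` vectors: the sigma-algebras generated by the vectors up to
index `l` and by the vectors with indices `t, …, s` are independent whenever `t - l > 1`. -/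
def OneDependent (μ : Measure Ω) (X : ℕ → Ω → Fin k → ℤ) (n : ℕ) : Prop :=
  ∀ l t s : ℕ, l + 1 < t → t ≤ s → s < n → Indep (sigmaGen X 0 l) (sigmaGen X t s) μ

/-- The distribution `F_n` of `S_n = X₁ + ⋯ + X_n`. -/
def sumDist (μ : Measure Ω) (X : ℕ → Ω → Fin k → ℤ) (n : ℕ) (m : Fin k → ℤ) : ℝ :=
  (μ.map (fun ω => ∑ i ∈ Finset.range n, X i ω)).real {m}

/-- `γ_j = max (1, √(n p_j))`. -/
def gam (μ : Measure Ω) (X : ℕ → Ω → Fin k → ℤ) (n : ℕ) (j : Fin k) : ℝ :=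
  max 1 (Real.sqrt (n * prob1 μ X j))

/-- `ε₂`. -/
def eps2 (μ : Measure Ω) (X : ℕ → Ω → Fin k → ℤ) (n : ℕ) : ℝ :=
  ∑ r, ∑ j, ∑ m,
    (prob3 μ X r j m + prob2 μ X r j * prob1 μ X m + prob1 μ X r * prob1 μ X j * prob1 μ X m) /
      (gam μ X n r * gam μ X n j * gam μ X n m)

end Probabilities

/-! The signed compound Poisson measure. Finitely supported signed measures on `ℤ^k` are elements
of `AddMonoidAlgebra ℝ (Fin k → ℤ)`, whose product is the convolution. -/

/-- `δ_{e_j} - δ_0`, the measure with Fourier transform `exp (i t_j) - 1`. -/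
def diffMeasure {k : ℕ} (j : Fin k) : AddMonoidAlgebra ℝ (Fin k → ℤ) :=
  AddMonoidAlgebra.single (coordVec j) 1 - 1

/-- The exponent of the signed compound Poisson measure, as a finitely supported signed measure. -/
def cpExponent {k : ℕ} (n : ℕ) (p : Fin k → ℝ) (q : Fin k → Fin k → ℝ) :
    AddMonoidAlgebra ℝ (Fin k → ℤ) :=
  (n : ℝ) • ∑ j, p j • diffMeasure j - ((n : ℝ) / 2) • (∑ j, p j • diffMeasure j) ^ 2
    + ((n : ℝ) - 1) • ∑ j, ∑ m, (q j m - p j * p m) • (diffMeasure j * diffMeasure m)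

/-- The point masses of the convolution exponential `∑_l a^{*l} / l!`. -/
def convExp {k : ℕ} (a : AddMonoidAlgebra ℝ (Fin k → ℤ)) (m : Fin k → ℤ) : ℝ :=
  ∑' l : ℕ, (a ^ l).coeff m / (l.factorial : ℝ)

/-- The signed compound Poisson measure `G`, with `p j = p_j` and `q j m = p_{jm}`. Its Fourier
transform is computed in `signedCP_hasFourierTransform`. -/
def signedCP {k : ℕ} (n : ℕ) (p : Fin k → ℝ) (q : Fin k → Fin k → ℝ) : (Fin k → ℤ) → ℝ :=
  convExp (cpExponent n p q)

/-- The Fourier transform of `G`. -/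
def signedCPFourier {k : ℕ} (n : ℕ) (p : Fin k → ℝ) (q : Fin k → Fin k → ℝ)
    (t : Fin k → ℝ) : ℂ :=
  Complex.exp (n * ∑ j, (p j : ℂ) * (Complex.exp (Complex.I * t j) - 1)) *
    Complex.exp (-(n / 2) * (∑ j, (p j : ℂ) * (Complex.exp (Complex.I * t j) - 1)) ^ 2
      + (n - 1) * ∑ j, ∑ m, ((q j m : ℂ) - p j * p m) *
          (Complex.exp (Complex.I * t j) - 1) * (Complex.exp (Complex.I * t m) - 1))

section FourierTransform

variable {k : ℕ}

/-- The character `m ↦ exp (i (m, t))`. -/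
def latticeChar (t : Fin k → ℝ) : Multiplicative (Fin k → ℤ) →* ℂ where
  toFun m := Complex.exp (Complex.I * ((∑ j, (m.toAdd j : ℝ) * t j : ℝ) : ℂ))
  map_one' := by simp
  map_mul' a b := by
    rw [← Complex.exp_add]
    congr 1
    simp [add_mul, Finset.sum_add_distrib, mul_add]

/-- The Fourier transform on finitely supported measures. -/
def finFourier (t : Fin k → ℝ) : AddMonoidAlgebra ℝ (Fin k → ℤ) →ₐ[ℝ] ℂ :=
  AddMonoidAlgebra.lift ℝ ℂ (Fin k → ℤ) (latticeChar t)

theorem finFourier_diffMeasure (t : Fin k → ℝ) (j : Fin k) :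
    finFourier t (diffMeasure j) = Complex.exp (Complex.I * t j) - 1 := by
  have : (∑ x, ((coordVec j x : ℤ) : ℂ) * (t x : ℂ)) = t j := by
    simp [coordVec, Pi.single_apply]
  simp [finFourier, diffMeasure, AddMonoidAlgebra.lift_single, latticeChar, this]

theorem finFourier_hasSum (t : Fin k → ℝ) (a : AddMonoidAlgebra ℝ (Fin k → ℤ)) :
    HasSum (fun m => (a.coeff m : ℂ) *
      Complex.exp (Complex.I * ((∑ j, (m j : ℝ) * t j : ℝ) : ℂ))) (finFourier t a) := by
  rw [finFourier, AddMonoidAlgebra.lift_apply']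
  refine hasSum_sum_of_ne_finset_zero ?_
  intro m hm
  simp [Finsupp.notMem_support_iff.mp hm]

theorem summable_coeff (a : AddMonoidAlgebra ℝ (Fin k → ℤ)) : Summable (fun m => |a.coeff m|) := by
  refine summable_of_ne_finset_zero (s := a.coeff.support) ?_
  intro m hm
  simp [Finsupp.notMem_support_iff.mp hm]

theorem tsum_coeff_mul_le (a b : AddMonoidAlgebra ℝ (Fin k → ℤ)) :
    ∑' m, |(a * b).coeff m| ≤ (∑' m, |a.coeff m|) * ∑' m, |b.coeff m| := by
  have hadd : ∀ f g : AddMonoidAlgebra ℝ (Fin k → ℤ),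
      ∑' m, |(f + g).coeff m| ≤ ∑' m, |f.coeff m| + ∑' m, |g.coeff m| := fun f g => by
    rw [← (summable_coeff f).tsum_add (summable_coeff g)]
    exact (summable_coeff _).tsum_le_tsum (fun m => abs_add_le _ _)
      ((summable_coeff f).add (summable_coeff g))
  have hsingle : ∀ x (r : ℝ),
      ∑' m, |(AddMonoidAlgebra.single x r * b).coeff m| = |r| * ∑' m, |b.coeff m| := fun x r => by
    simp only [AddMonoidAlgebra.coeff_single_mul_apply, abs_mul, tsum_mul_left]
    congr 1
    exact (Equiv.addLeft (-x)).tsum_eq (fun m => |b.coeff m|)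
  have ha : a = ∑ x ∈ a.coeff.support, AddMonoidAlgebra.single x (a.coeff x) :=
    (AddMonoidAlgebra.sum_coeff_single a).symm
  have hN : ∑' m, |a.coeff m| = ∑ x ∈ a.coeff.support, |a.coeff x| :=
    tsum_eq_sum fun m hm => by simp [Finsupp.notMem_support_iff.mp hm]
  rw [hN, Finset.sum_mul]
  conv_lhs => rw [ha, Finset.sum_mul]
  rw [Finset.sum_congr rfl fun x _ => (hsingle x (a.coeff x)).symm]
  exact Finset.le_sum_of_subadditive (fun f : AddMonoidAlgebra ℝ (Fin k → ℤ) => ∑' m, |f.coeff m|)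
    (by simp) hadd _ _

theorem tsum_coeff_pow_le (a : AddMonoidAlgebra ℝ (Fin k → ℤ)) (l : ℕ) :
    ∑' m, |(a ^ l).coeff m| ≤ (∑' m, |a.coeff m|) ^ l := by
  induction l with
  | zero =>
    rw [pow_zero, pow_zero, AddMonoidAlgebra.one_def, tsum_eq_single 0]
    · simp
    · intro m hm
      simp [hm.symm]
  | succ l ih =>
    rw [pow_succ, pow_succ]
    exact (tsum_coeff_mul_le _ _).trans
      (mul_le_mul_of_nonneg_right ih (tsum_nonneg fun _ => abs_nonneg _))

theorem summable_convExp (a : AddMonoidAlgebra ℝ (Fin k → ℤ)) :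
    Summable (fun x : ℕ × (Fin k → ℤ) => |(a ^ x.1).coeff x.2 / (x.1.factorial : ℝ)|) := by
  rw [summable_prod_of_nonneg (fun _ => abs_nonneg _)]
  simp only [abs_div, Nat.abs_cast, tsum_div_const]
  refine ⟨fun l => (summable_coeff _).div_const _, ?_⟩
  refine Summable.of_nonneg_of_le
    (fun l => div_nonneg (tsum_nonneg fun _ => abs_nonneg _) (Nat.cast_nonneg _)) (fun l => ?_)
    (Real.summable_pow_div_factorial (∑' m, |a.coeff m|))
  exact div_le_div_of_nonneg_right (tsum_coeff_pow_le a l) (Nat.cast_nonneg _)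

theorem convExp_hasFourierTransform (a : AddMonoidAlgebra ℝ (Fin k → ℤ)) :
    HasFourierTransform (convExp a) (fun t => Complex.exp (finFourier t a)) := by
  have hs := summable_convExp a
  have hs' := hs.prod_symm
  refine ⟨?_, fun t => ?_⟩
  · refine Summable.of_nonneg_of_le (fun _ => abs_nonneg _) (fun m => ?_) hs'.prod
    have h := hs'.prod_factor m
    simp only [Prod.swap_prod_mk] at h ⊢
    simp only [← Real.norm_eq_abs] at h ⊢
    exact norm_tsum_le_tsum_norm h
  · obtain ⟨e, he⟩ : ∃ e : (Fin k → ℤ) → ℂ, e = fun m =>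
      Complex.exp (Complex.I * ((∑ j, (m j : ℝ) * t j : ℝ) : ℂ)) := ⟨_, rfl⟩
    have hn : ∀ m, ‖e m‖ = 1 := fun m => by
      simp only [he]
      rw [mul_comm, Complex.norm_exp_ofReal_mul_I]
    obtain ⟨f, hfe⟩ : ∃ f : (Fin k → ℤ) × ℕ → ℂ, ∀ m l, f (m, l) =
      (((a ^ l).coeff m / (l.factorial : ℝ) : ℝ) : ℂ) * e m :=
        ⟨fun x => (((a ^ x.2).coeff x.1 / (x.2.factorial : ℝ) : ℝ) : ℂ) * e x.1, fun _ _ => rfl⟩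
    have hf : Summable f := by
      refine Summable.of_norm ?_
      refine hs'.congr fun x => ?_
      obtain ⟨m, l⟩ := x
      rw [hfe, norm_mul, hn, mul_one, Complex.norm_real, Real.norm_eq_abs]
      rfl
    have h1 : ∀ m, HasSum (fun l => f (m, l)) ((convExp a m : ℂ) * e m) := fun m => by
      simp only [hfe]
      refine HasSum.mul_right _ ?_
      rw [Complex.hasSum_ofReal]
      have h := hs'.prod_factor m
      simp only [Prod.swap_prod_mk] at h
      exact h.of_abs.hasSum
    have h2 : ∀ l, HasSum (fun m => f (m, l)) (finFourier t a ^ l / (l.factorial : ℂ)) := fun l => by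
      have := (finFourier_hasSum t (a ^ l)).div_const (l.factorial : ℂ)
      rw [map_pow] at this
      refine HasSum.congr_fun this ?_
      intro m
      rw [hfe, he]
      push_cast
      ring
    have h3 : HasSum (fun l : ℕ => finFourier t a ^ l / (l.factorial : ℂ))
        (Complex.exp (finFourier t a)) := by
      rw [Complex.exp_eq_exp_ℂ]
      exact NormedSpace.expSeries_div_hasSum_exp _
    have h4 : HasSum (fun x : ℕ × (Fin k → ℤ) => f (x.2, x.1)) (∑' x, f x) :=
      (Equiv.prodComm ℕ (Fin k → ℤ)).hasSum_iff.mpr hf.hasSum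
    have h5 := h4.prod_fiberwise h2
    have h6 := hf.hasSum.prod_fiberwise h1
    rw [← h3.unique h5, he] at h6
    exact h6

/-- `G` is a finite signed measure on `ℤ^k` with the required Fourier transform. -/
theorem signedCP_hasFourierTransform (n : ℕ) (p : Fin k → ℝ) (q : Fin k → Fin k → ℝ) :
    HasFourierTransform (signedCP n p q) (signedCPFourier n p q) := by
  have h : signedCPFourier n p q = fun t => Complex.exp (finFourier t (cpExponent n p q)) := by
    funext t
    rw [signedCPFourier, ← Complex.exp_add]
    congr 1
    simp only [cpExponent, map_add, map_sub, map_smul, map_sum, map_pow, map_mul,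
      finFourier_diffMeasure, Complex.real_smul]
    push_cast
    simp only [mul_assoc]
    ring
  rw [h]
  exact convExp_hasFourierTransform _

end FourierTransform

end

/-! With `Y_i = ∑_j 1{X_i = e_j} (e^{i t_j} - 1)`, the Fourier transform of `F_n` is `D n`, where
`D m = E ∏_{i < m} (1 + Y_i)`. Expanding the product according to the run of indices that ends at
the last one, and using that 1-dependence separates a run from everything two steps before it,
gives a linear recursion for `D` (`integral_prod_one_add_succ`) whose first coefficients are
`s = E Y_0` and `q = E Y_0 Y_1`; the later ones decay geometrically (`runMoment_add_le`). Under the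
smallness assumptions, an induction shows that the ratios `D (m + 1) / D m` are close to `1`
(`RunExpansion.growth`), that they are at most `exp (-P / 20)` in modulus with
`P = ∑ p_j |e^{i t_j} - 1|²` (`RunExpansion.norm_ratio_le`), and that they agree with
`exp (s - 3 s² / 2 + q)` (with `exp (s - s² / 2)` for `m = 0`) up to the third order quantity
`b₁³ + b₁ b₂ + b₃`, the `b_l` being absolute moments of runs of length `l`
(`RunExpansion.norm_ratio_sub_localFactor_le`). The product of these exponentials is exactly the
transform of `G`, so telescoping bounds the difference of the transforms by
`64 n (b₁³ + b₁ b₂ + b₃) exp (-n P / 20)`.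

Half of the exponential turns every factor `|e^{i t_r} - 1|` of the third order term into
`O(1 / γ_r)`, which produces `ε₂` (`moments_mul_exp_le`); the other half is integrable over the
cube `(-π, π]^k` with integral `O(∏ γ_j⁻¹)` (`integral_cubeGaussian_le`). Fourier inversion then
bounds `‖F_n - G‖_∞` and Parseval's identity bounds `‖F_n - G‖_2`. For `α ≥ 2` the inequality
`‖M‖_α^α ≤ ‖M‖_∞^{α - 2} ‖M‖_2²` interpolates between the two without loss in the powers of the
`γ_j` (`HasFourierTransform.latticeNorm_le_of_bound`). -/

/-! ### Recursions with geometrically decaying coefficients -/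

/-- A sequence `D 0, …, D n` satisfying the recursion that 1-dependence imposes on
`D m = E ∏_{i < m} (1 + Y_i)`: the coefficient `a m i` stands for `E Y_{m-i} ⋯ Y_m`, the
expectation over a run of `i + 1` consecutive variables that ends at `m`. For `i = m` and
`i + 1 = m` the index `m - i - 1` is `0`, in the first case by truncation, which is right since no
variable precedes the run. The numbers `b₁`, `b₂`, `b₃` are the absolute moments of runs of length
one, two, three, and `P = ∑ p_j |e^{i t_j} - 1|²` governs the decay of `D`; longer runs decay
geometrically because a variable is independent of those at least two steps before it. -/
structure RunExpansion (n : ℕ) (D : ℕ → ℂ) (a : ℕ → ℕ → ℂ) (s q : ℂ) (b₁ b₂ b₃ P : ℝ) :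
    Prop where
  zero : D 0 = 1
  succ : ∀ m < n, D (m + 1) = D m + ∑ i ∈ Finset.range (m + 1), a m i * D (m - i - 1)
  run_one : ∀ m < n, a m 0 = s
  run_two : ∀ m < n, 1 ≤ m → a m 1 = q
  run_le_two : ∀ m < n, ∀ i, i + 2 ≤ m → ‖a m (i + 2)‖ ≤ 12 * (b₂ / 6) * (1 / 6) ^ i
  run_le_three : ∀ m < n, ∀ i, i + 2 ≤ m → ‖a m (i + 2)‖ ≤ 12 * b₃ * (1 / 6) ^ i
  norm_s : ‖s‖ ≤ b₁
  norm_q : ‖q‖ ≤ b₂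
  re_s : s.re = -P / 2
  b₃_nonneg : 0 ≤ b₃
  b₁_sq : b₁ ^ 2 ≤ P / 144
  b₁_le : b₁ ≤ 1 / 72
  P_le : P ≤ 1
  b₂_le_P : b₂ ≤ P / 10
  b₂_le : b₂ ≤ 1 / 360
  b₂_le_b₁ : b₂ ≤ 2 * b₁

/-- The ratio of the dominating geometric series is `16 / 15 · 1 / 6 = 8 / 45`. -/
theorem norm_sum_geometric_le {c d : ℕ → ℂ} {β N : ℝ} (m : ℕ) (hβ : 0 ≤ β) (hN : 0 ≤ N)
    (hc : ∀ i < m, ‖c i‖ ≤ 12 * β * (1 / 6) ^ i) (hd : ∀ i < m, ‖d i‖ ≤ (16 / 15) ^ (i + 3) * N) :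
    ‖∑ i ∈ Finset.range m, c i * d i‖ ≤ 18 * β * N := by
  have h1 : ∀ i ∈ Finset.range m,
      ‖c i * d i‖ ≤ (12 * (16 / 15) ^ 3 * β * N) * (8 / 45) ^ i := fun i hi => by
    rw [norm_mul]
    have hi := Finset.mem_range.mp hi
    calc ‖c i‖ * ‖d i‖ ≤ (12 * β * (1 / 6) ^ i) * ((16 / 15) ^ (i + 3) * N) :=
          mul_le_mul (hc i hi) (hd i hi) (norm_nonneg _) (by positivity)
      _ = (12 * (16 / 15) ^ 3 * β * N) * ((1 / 6) ^ i * (16 / 15) ^ i) := by ring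
      _ = _ := by rw [← mul_pow]; norm_num
  have h2 : ∑ i ∈ Finset.range m, (8 / 45 : ℝ) ^ i ≤ 45 / 37 := by
    rw [geom_sum_eq (by norm_num), div_le_iff_of_neg (by norm_num)]
    have : (0 : ℝ) ≤ (8 / 45) ^ m := by positivity
    linarith
  calc _ ≤ _ := norm_sum_le _ _
    _ ≤ _ := Finset.sum_le_sum h1
    _ = (12 * (16 / 15) ^ 3 * β * N) * ∑ i ∈ Finset.range m, (8 / 45 : ℝ) ^ i :=
      (Finset.mul_sum _ _ _).symm
    _ ≤ (12 * (16 / 15) ^ 3 * β * N) * (45 / 37) := by gcongr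
    _ ≤ _ := by nlinarith [mul_nonneg hβ hN]

namespace RunExpansion

variable {n : ℕ} {D : ℕ → ℂ} {a : ℕ → ℕ → ℂ} {s q : ℂ} {b₁ b₂ b₃ P : ℝ}

theorem b₁_nonneg (h : RunExpansion n D a s q b₁ b₂ b₃ P) : 0 ≤ b₁ :=
  (norm_nonneg _).trans h.norm_s

theorem b₂_nonneg (h : RunExpansion n D a s q b₁ b₂ b₃ P) : 0 ≤ b₂ :=
  (norm_nonneg _).trans h.norm_q

/-- Runs of length at least three are collected in a remainder `R`. Its two bounds serve
different purposes: `3 b₂` for the decay of `D`, `18 b₃` for the approximation. -/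
theorem exists_remainder (h : RunExpansion n D a s q b₁ b₂ b₃ P) {m : ℕ} (hm : m < n)
    (hD : ∀ i, ‖D (m - i)‖ ≤ (16 / 15) ^ i * ‖D m‖) :
    ∃ R, D (m + 1) = D m + s * D (m - 1) + (if m = 0 then 0 else q) * D (m - 2) + R ∧
      ‖R‖ ≤ 3 * b₂ * ‖D m‖ ∧ ‖R‖ ≤ 18 * b₃ * ‖D m‖ := by
  have hb₂ := h.b₂_nonneg
  have hb₃ := h.b₃_nonneg
  rcases m with _ | m
  · refine ⟨0, ?_, ?_, ?_⟩
    · rw [h.succ 0 hm]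
      simp [h.run_one 0 hm]
    · rw [norm_zero]
      positivity
    · rw [norm_zero]
      positivity
  · refine ⟨∑ i ∈ Finset.range m, a (m + 1) (i + 2) * D (m + 1 - (i + 3)), ?_, ?_, ?_⟩
    · rw [h.succ _ hm, Finset.sum_range_succ', Finset.sum_range_succ', h.run_one _ hm,
        h.run_two _ hm (by omega)]
      simp only [Nat.sub_sub, Nat.reduceAdd, add_assoc]
      simp
      ring
    · refine (norm_sum_geometric_le m (by positivity : 0 ≤ b₂ / 6) (norm_nonneg (D (m + 1)))
        (fun i hi => h.run_le_two _ hm i (by omega)) (fun i _ => hD _)).trans (le_of_eq ?_)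
      ring
    · exact norm_sum_geometric_le m hb₃ (norm_nonneg (D (m + 1)))
        (fun i hi => h.run_le_three _ hm i (by omega)) (fun i _ => hD _)

/-- The ratios `D (m + 1) / D m` stay in the disc of radius `1 / 16` about `1`, hence going back
one step costs a factor at most `16 / 15`; this is the form in which the induction uses it. -/
theorem growth (h : RunExpansion n D a s q b₁ b₂ b₃ P) {m : ℕ} (hm : m ≤ n) :
    D m ≠ 0 ∧ ∀ i, ‖D (m - i)‖ ≤ (16 / 15) ^ i * ‖D m‖ := by
  have hb₁ := h.b₁_nonneg
  have hb₂ := h.b₂_nonneg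
  induction m with
  | zero =>
    refine ⟨by simp [h.zero], fun i => ?_⟩
    simpa [h.zero] using one_le_pow₀ (by norm_num : (1 : ℝ) ≤ 16 / 15)
  | succ m ih =>
    obtain ⟨h0, hD⟩ := ih (by omega)
    obtain ⟨R, hR, hR2, -⟩ := h.exists_remainder (by omega) hD
    have hpos : 0 < ‖D m‖ := norm_pos_iff.mpr h0
    have h1 : ‖s * D (m - 1)‖ ≤ b₁ * ((16 / 15) ^ 1 * ‖D m‖) := by
      rw [norm_mul]
      exact mul_le_mul h.norm_s (hD 1) (norm_nonneg _) hb₁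
    have h2 : ‖(if m = 0 then 0 else q) * D (m - 2)‖ ≤ b₂ * ((16 / 15) ^ 2 * ‖D m‖) := by
      rw [norm_mul]
      refine mul_le_mul ?_ (hD 2) (norm_nonneg _) hb₂
      split_ifs
      · simpa using hb₂
      · exact h.norm_q
    have h3 : ‖D (m + 1) - D m‖ ≤ 1 / 16 * ‖D m‖ := by
      rw [hR, show D m + s * D (m - 1) + (if m = 0 then 0 else q) * D (m - 2) + R - D m =
        s * D (m - 1) + (if m = 0 then 0 else q) * D (m - 2) + R by ring]
      refine (norm_add₃_le).trans ?_
      nlinarith [h.b₁_le, h.b₂_le]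
    have h4 : ‖D m‖ ≤ 16 / 15 * ‖D (m + 1)‖ := by
      have := norm_sub_norm_le (D m) (D (m + 1))
      rw [norm_sub_rev] at this
      linarith
    refine ⟨fun h => ?_, fun i => ?_⟩
    · rw [h, norm_zero, mul_zero] at h4
      linarith
    · rcases i with _ | i
      · simp
      · rw [show m + 1 - (i + 1) = m - i by omega]
        calc _ ≤ _ := hD i
          _ ≤ (16 / 15) ^ i * (16 / 15 * ‖D (m + 1)‖) := by gcongr
          _ = _ := by ring

/-- The ratio `D (m + 1) / D m = 1 + w` in terms of the backward ratios `u = D (m - 1) / D m` and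
`v = D (m - 2) / D m`. -/
theorem exists_ratio (h : RunExpansion n D a s q b₁ b₂ b₃ P) {m : ℕ} (hm : m < n) :
    ∃ R, D (m + 1) / D m - 1 = s * (D (m - 1) / D m) +
        (if m = 0 then 0 else q) * (D (m - 2) / D m) + R ∧
      ‖R‖ ≤ 3 * b₂ ∧ ‖R‖ ≤ 18 * b₃ ∧ ‖D (m - 1) / D m‖ ≤ 16 / 15 ∧
      ‖D (m - 2) / D m‖ ≤ 256 / 225 := by
  obtain ⟨h0, hD⟩ := h.growth hm.le
  obtain ⟨R, hR, hR2, hR3⟩ := h.exists_remainder hm hD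
  have hpos : 0 < ‖D m‖ := norm_pos_iff.mpr h0
  refine ⟨R / D m, ?_, ?_, ?_, ?_, ?_⟩
  · rw [hR]
    field_simp
    ring
  · rw [norm_div, div_le_iff₀ hpos]
    exact hR2
  · rw [norm_div, div_le_iff₀ hpos]
    exact hR3
  · rw [norm_div, div_le_iff₀ hpos]
    simpa using hD 1
  · rw [norm_div, div_le_iff₀ hpos]
    refine (hD 2).trans (le_of_eq ?_)
    norm_num

theorem norm_rest_le (h : RunExpansion n D a s q b₁ b₂ b₃ P) {m : ℕ} {v R : ℂ}
    (hv : ‖v‖ ≤ 256 / 225) (hR : ‖R‖ ≤ 3 * b₂) :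
    ‖(if m = 0 then 0 else q) * v + R‖ ≤ 4.14 * b₂ := by
  have hb₂ := h.b₂_nonneg
  have h1 : ‖(if m = 0 then 0 else q) * v‖ ≤ b₂ * (256 / 225) := by
    rw [norm_mul]
    refine mul_le_mul ?_ hv (norm_nonneg _) hb₂
    split_ifs
    · simpa using hb₂
    · exact h.norm_q
  refine (norm_add_le _ _).trans ?_
  linarith

theorem norm_ratio_sub_one_le (h : RunExpansion n D a s q b₁ b₂ b₃ P) {m : ℕ} (hm : m < n) :
    ‖D (m + 1) / D m - 1‖ ≤ 16 / 15 * b₁ + 4.14 * b₂ := by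
  obtain ⟨R, hw, hR, -, hu, hv⟩ := h.exists_ratio hm
  have hb₁ := h.b₁_nonneg
  rw [hw, add_assoc]
  refine (norm_add_le _ _).trans (add_le_add ?_ (h.norm_rest_le hv hR))
  rw [norm_mul, mul_comm]
  exact mul_le_mul hu h.norm_s (norm_nonneg _) (by norm_num)

theorem norm_back_sub_one_le (h : RunExpansion n D a s q b₁ b₂ b₃ P) {m : ℕ} (hm : m < n) :
    ‖D (m - 1) / D m - 1‖ ≤ 16 / 15 * (16 / 15 * b₁ + 4.14 * b₂) := by
  have hb₁ := h.b₁_nonneg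
  have hb₂ := h.b₂_nonneg
  rcases m with _ | m
  · simp only [zero_tsub]
    rw [div_self (h.growth (Nat.zero_le n)).1, sub_self, norm_zero]
    positivity
  · obtain ⟨R, -, -, -, hu, -⟩ := h.exists_ratio hm
    have e : D (m + 1 - 1) / D (m + 1) - 1 =
        -((D (m + 1 - 1) / D (m + 1)) * (D (m + 1) / D m - 1)) := by
      have h1 := (h.growth hm.le).1
      have h2 := (h.growth (m := m) (by omega)).1
      simp only [add_tsub_cancel_right]
      field_simp
      ring
    rw [e, norm_neg, norm_mul]
    exact mul_le_mul hu (h.norm_ratio_sub_one_le (by omega)) (norm_nonneg _) (by norm_num)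

/-- Exponential decay of the ratios: the real part of `D (m + 1) / D m - 1` is dominated by
`Re s = -P / 2`. -/
theorem norm_ratio_le (h : RunExpansion n D a s q b₁ b₂ b₃ P) {m : ℕ} (hm : m < n) :
    ‖D (m + 1) / D m‖ ≤ Real.exp (-(P / 20)) := by
  have hb₁ := h.b₁_nonneg
  have hb₂ := h.b₂_nonneg
  obtain ⟨R, hw, hR, -, hu, hv⟩ := h.exists_ratio hm
  have hr := h.norm_rest_le (m := m) hv hR
  have hw1 := h.norm_ratio_sub_one_le hm
  have hu1 := h.norm_back_sub_one_le hm
  set w := D (m + 1) / D m - 1 with hwdef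
  set u := D (m - 1) / D m
  set v := D (m - 2) / D m
  have hP := h.b₁_sq
  have hP2 := h.b₂_le_P
  have h1 := h.b₁_le
  have h2 := h.b₂_le
  have hsu : ‖s * (u - 1)‖ ≤ b₁ * (16 / 15 * (16 / 15 * b₁ + 4.14 * b₂)) := by
    rw [norm_mul]
    exact mul_le_mul h.norm_s hu1 (norm_nonneg _) hb₁
  have hre : w.re ≤ -P / 2 + b₁ * (16 / 15 * (16 / 15 * b₁ + 4.14 * b₂)) + 4.14 * b₂ := by
    have e : w = s + (s * (u - 1) + ((if m = 0 then 0 else q) * v + R)) := by rw [hw]; ring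
    rw [e, Complex.add_re, h.re_s, add_assoc]
    gcongr
    exact (Complex.re_le_norm _).trans ((norm_add_le _ _).trans (add_le_add hsu hr))
  have hw2 : ‖w‖ ^ 2 ≤ (16 / 15 * b₁ + 4.14 * b₂) ^ 2 := by gcongr
  have hsq : ‖1 + w‖ ^ 2 = 1 + 2 * w.re + ‖w‖ ^ 2 := by
    rw [← Complex.normSq_eq_norm_sq, ← Complex.normSq_eq_norm_sq, Complex.normSq_apply,
      Complex.normSq_apply]
    simp
    ring
  have hb₁₂ : b₁ * b₂ ≤ 1 / 72 * (P / 10) := mul_le_mul h1 hP2 hb₂ (by norm_num)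
  have hb₂₂ : b₂ * b₂ ≤ 1 / 360 * (P / 10) := mul_le_mul h2 hP2 hb₂ (by norm_num)
  have hfin : ‖1 + w‖ ^ 2 ≤ 1 + -(P / 10) := by
    rw [hsq]
    nlinarith
  have hexp : ‖1 + w‖ ^ 2 ≤ Real.exp (-(P / 20)) ^ 2 := by
    have e : ((2 : ℕ) : ℝ) * -(P / 20) = -(P / 10) := by push_cast; ring
    rw [← Real.exp_nat_mul, e]
    linarith [Real.add_one_le_exp (-(P / 10))]
  have : D (m + 1) / D m = 1 + w := by rw [hwdef]; ring
  rw [this]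
  exact (pow_le_pow_iff_left₀ (norm_nonneg _) (Real.exp_pos _).le two_ne_zero).mp hexp

end RunExpansion

/-! ### Comparison with the factors of the compound Poisson transform -/

/-- The local factor of the signed compound Poisson transform that the ratio
`D (m + 1) / D m` is compared with. The first factor lacks the terms created by the dependence on
the preceding variable. -/
noncomputable def localFactor (s q : ℂ) (m : ℕ) : ℂ :=
  if m = 0 then Complex.exp (s - s ^ 2 / 2) else Complex.exp (s - 3 / 2 * s ^ 2 + q)

theorem norm_exp_sub_quadratic_le {x : ℂ} (hx : ‖x‖ ≤ 1) :
    ‖Complex.exp x - (1 + x + x ^ 2 / 2)‖ ≤ ‖x‖ ^ 3 := by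
  have h := Complex.exp_bound hx (n := 3) (by norm_num)
  have e : ∑ m ∈ Finset.range 3, x ^ m / (m.factorial : ℂ) = 1 + x + x ^ 2 / 2 := by
    simp [Finset.sum_range_succ, Nat.factorial]
  rw [e] at h
  refine h.trans (mul_le_of_le_one_right (by positivity) ?_)
  norm_num [Nat.factorial]

theorem norm_exp_add_sub_le {s y : ℂ} {b : ℝ} (hb : b ≤ 1 / 72) (hs : ‖s‖ ≤ b)
    (hy : ‖y‖ ≤ 2.1 * b) :
    ‖Complex.exp (s + y) - (1 + s + s ^ 2 / 2 + y)‖ ≤ 2.05 * b * ‖y‖ + 30 * b ^ 3 := by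
  have hb0 : 0 ≤ b := (norm_nonneg _).trans hs
  have hx : ‖s + y‖ ≤ 3.1 * b := (norm_add_le _ _).trans (by linarith)
  have h1 := norm_exp_sub_quadratic_le (hx.trans (by linarith))
  have h2 : ‖s * y + y ^ 2 / 2‖ ≤ 2.05 * b * ‖y‖ := by
    refine (norm_add_le _ _).trans ?_
    rw [norm_mul, norm_div, norm_pow]
    simp only [Complex.norm_ofNat]
    nlinarith [norm_nonneg y]
  have h3 : ‖s + y‖ ^ 3 ≤ (3.1 * b) ^ 3 := by gcongr
  rw [show Complex.exp (s + y) - (1 + s + s ^ 2 / 2 + y) =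
    (s * y + y ^ 2 / 2) + (Complex.exp (s + y) - (1 + (s + y) + (s + y) ^ 2 / 2)) by ring]
  refine (norm_add_le _ _).trans ?_
  have : 0 ≤ b ^ 3 := by positivity
  linarith

namespace RunExpansion

variable {n : ℕ} {D : ℕ → ℂ} {a : ℕ → ℕ → ℂ} {s q : ℂ} {b₁ b₂ b₃ P : ℝ}

theorem P_nonneg (h : RunExpansion n D a s q b₁ b₂ b₃ P) : 0 ≤ P := by
  nlinarith [h.b₁_sq, sq_nonneg b₁]

theorem norm_exponent_le (h : RunExpansion n D a s q b₁ b₂ b₃ P) :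
    ‖q - 3 / 2 * s ^ 2‖ ≤ b₂ + 3 / 2 * b₁ ^ 2 := by
  refine (norm_sub_le _ _).trans (add_le_add h.norm_q ?_)
  rw [norm_mul, norm_pow]
  have := h.norm_s
  norm_num
  gcongr

/-- The term `-s²` comes from the backward ratio `D m / D (m + 1) = 1 - s + O(b₁² + b₂)` that
multiplies `s` in the recursion. -/
theorem norm_ratio_sub_expansion_le (h : RunExpansion n D a s q b₁ b₂ b₃ P) {m : ℕ}
    (hm : m + 1 < n) :
    ‖D (m + 2) / D (m + 1) - (1 + s - s ^ 2 + q)‖ ≤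
      26 * (b₁ ^ 3 + b₁ * b₂ + b₃) := by
  have hb₁ := h.b₁_nonneg
  have hb₂ := h.b₂_nonneg
  have hb₃ := h.b₃_nonneg
  have hb₁₁ := h.b₁_le
  have hb₂₁ := h.b₂_le_b₁
  obtain ⟨R, hw, -, hR, hu, hv⟩ := h.exists_ratio hm
  obtain ⟨R', hw', hR', -, hu', hv'⟩ := h.exists_ratio (m := m) (by omega)
  have hu1 := h.norm_back_sub_one_le hm
  have hu1' := h.norm_back_sub_one_le (m := m) (by omega)
  have hr' := h.norm_rest_le (m := m) hv' hR'
  have h0 := (h.growth (m := m) (by omega)).1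
  have h1 := (h.growth (m := m + 1) (by omega)).1
  have ev : D (m + 1 - 2) / D (m + 1) = (D (m + 1 - 1) / D (m + 1)) * (D (m - 1) / D m) := by
    simp only [add_tsub_cancel_right, show m + 1 - 2 = m - 1 by omega]
    field_simp
  have eu : D (m + 1 - 1) / D (m + 1) - 1 =
      -((D (m + 1) / D m - 1) * (D (m + 1 - 1) / D (m + 1))) := by
    simp only [add_tsub_cancel_right]
    field_simp
    ring
  rw [ev, if_neg (Nat.succ_ne_zero m)] at hw
  set u := D (m + 1 - 1) / D (m + 1)
  set u' := D (m - 1) / D m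
  set w' := D (m + 1) / D m - 1
  set v' := D (m - 2) / D m
  have hq := h.norm_q
  have hs := h.norm_s
  have hu2 : ‖u - 1‖ ≤ 10 * b₁ := hu1.trans (by linarith)
  have hu2' : ‖u' - 1‖ ≤ 10 * b₁ := hu1'.trans (by linarith)
  have hw2 : ‖w' - s‖ ≤ 1.14 * b₁ ^ 2 + 4.21 * b₂ := by
    rw [show w' - s = s * (u' - 1) + ((if m = 0 then 0 else q) * v' + R') by rw [hw']; ring]
    refine (norm_add_le _ _).trans ?_
    have : ‖s * (u' - 1)‖ ≤ b₁ * (16 / 15 * (16 / 15 * b₁ + 4.14 * b₂)) := by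
      rw [norm_mul]
      exact mul_le_mul hs hu1' (norm_nonneg _) hb₁
    nlinarith
  have hu3 : ‖u - 1 + s‖ ≤ 3 * b₁ ^ 2 + 5 * b₂ := by
    rw [show u - 1 + s = -((w' - s) * u) + -(s * (u - 1)) by
      linear_combination eu]
    refine (norm_add_le _ _).trans ?_
    rw [norm_neg, norm_neg, norm_mul, norm_mul]
    have h1 : ‖w' - s‖ * ‖u‖ ≤ (1.14 * b₁ ^ 2 + 4.21 * b₂) * (16 / 15) :=
      mul_le_mul hw2 hu (norm_nonneg _) (by positivity)
    have h2 : ‖s‖ * ‖u - 1‖ ≤ b₁ * (16 / 15 * (16 / 15 * b₁ + 4.14 * b₂)) :=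
      mul_le_mul hs hu1 (norm_nonneg _) hb₁
    nlinarith
  have hv1 : ‖u * u' - 1‖ ≤ 21 * b₁ := by
    rw [show u * u' - 1 = u * (u' - 1) + (u - 1) by ring]
    refine (norm_add_le _ _).trans ?_
    rw [norm_mul]
    have h1 : ‖u‖ * ‖u' - 1‖ ≤ 16 / 15 * (10 * b₁) :=
      mul_le_mul hu hu2' (norm_nonneg _) (by norm_num)
    linarith
  rw [show D (m + 2) / D (m + 1) - (1 + s - s ^ 2 + q) =
    s * (u - 1 + s) + q * (u * u' - 1) + R by linear_combination hw]
  refine norm_add₃_le.trans ?_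
  rw [norm_mul, norm_mul]
  have h2 : ‖s‖ * ‖u - 1 + s‖ ≤ b₁ * (3 * b₁ ^ 2 + 5 * b₂) :=
    mul_le_mul hs hu3 (norm_nonneg _) hb₁
  have h3 : ‖q‖ * ‖u * u' - 1‖ ≤ b₂ * (21 * b₁) := mul_le_mul hq hv1 (norm_nonneg _) hb₂
  have : 0 ≤ b₁ ^ 3 := by positivity
  linarith

theorem norm_ratio_sub_localFactor_le (h : RunExpansion n D a s q b₁ b₂ b₃ P) {m : ℕ}
    (hm : m < n) :
    ‖D (m + 1) / D m - localFactor s q m‖ ≤ 60 * (b₁ ^ 3 + b₁ * b₂ + b₃) := by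
  have hb₁ := h.b₁_nonneg
  have hb₂ := h.b₂_nonneg
  have hb₃ := h.b₃_nonneg
  have hb₁₁ := h.b₁_le
  have hs := h.norm_s
  have h12 : 0 ≤ b₁ * b₂ := mul_nonneg hb₁ hb₂
  have h111 : 0 ≤ b₁ ^ 3 := by positivity
  rcases m with _ | m
  · have hy : ‖-(s ^ 2 / 2)‖ ≤ b₁ ^ 2 / 2 := by
      rw [norm_neg, norm_div, norm_pow, Complex.norm_ofNat]
      gcongr
    have h1 := norm_exp_add_sub_le hb₁₁ hs (hy.trans (by nlinarith))
    have e : D (0 + 1) / D 0 = 1 + s := by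
      simp [h.succ 0 hm, h.zero, h.run_one 0 hm]
    rw [e, localFactor, if_pos rfl, norm_sub_rev]
    rw [show (1 : ℂ) + s + s ^ 2 / 2 + -(s ^ 2 / 2) = 1 + s by ring,
      show s + -(s ^ 2 / 2) = s - s ^ 2 / 2 by ring] at h1
    have : b₁ * ‖-(s ^ 2 / 2)‖ ≤ b₁ * (b₁ ^ 2 / 2) := by gcongr
    nlinarith
  · have hy := h.norm_exponent_le
    have h1 := norm_exp_add_sub_le hb₁₁ hs (hy.trans (by nlinarith [h.b₂_le_b₁]))
    have h2 := h.norm_ratio_sub_expansion_le hm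
    rw [localFactor, if_neg (Nat.succ_ne_zero m)]
    rw [show s + (q - 3 / 2 * s ^ 2) = s - 3 / 2 * s ^ 2 + q by ring,
      show 1 + s + s ^ 2 / 2 + (q - 3 / 2 * s ^ 2) = 1 + s - s ^ 2 + q by ring, norm_sub_rev] at h1
    refine (norm_sub_le_norm_sub_add_norm_sub _ (1 + s - s ^ 2 + q) _).trans ?_
    have : b₁ * ‖q - 3 / 2 * s ^ 2‖ ≤ b₁ * (b₂ + 3 / 2 * b₁ ^ 2) := by gcongr
    nlinarith

theorem norm_localFactor_le (h : RunExpansion n D a s q b₁ b₂ b₃ P) (m : ℕ) :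
    ‖localFactor s q m‖ ≤ Real.exp (-(P / 20)) := by
  have hb₁ := h.b₁_nonneg
  have hb₂ := h.b₂_nonneg
  have h1 := h.b₁_sq
  have h2 := h.b₂_le_P
  have hP := h.P_nonneg
  have hre := h.re_s
  rw [localFactor]
  split_ifs
  · rw [Complex.norm_exp, Real.exp_le_exp, Complex.sub_re, hre]
    have h3 : ‖s ^ 2 / 2‖ ≤ b₁ ^ 2 / 2 := by
      rw [norm_div, norm_pow, Complex.norm_ofNat]
      have := h.norm_s
      gcongr
    have := (abs_le.mp ((Complex.abs_re_le_norm _).trans h3)).1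
    linarith
  · rw [Complex.norm_exp, Real.exp_le_exp,
      show s - 3 / 2 * s ^ 2 + q = s + (q - 3 / 2 * s ^ 2) by ring, Complex.add_re, hre]
    have := (Complex.re_le_norm _).trans h.norm_exponent_le
    linarith

theorem norm_sub_prod_localFactor_le (h : RunExpansion n D a s q b₁ b₂ b₃ P) :
    ‖D n - ∏ m ∈ Finset.range n, localFactor s q m‖ ≤
      64 * n * (b₁ ^ 3 + b₁ * b₂ + b₃) * Real.exp (-(P / 20)) ^ n := by
  have hb₁ := h.b₁_nonneg
  have hb₂ := h.b₂_nonneg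
  have hb₃ := h.b₃_nonneg
  set r := Real.exp (-(P / 20)) with hr
  have hr0 : 0 < r := Real.exp_pos _
  set e := b₁ ^ 3 + b₁ * b₂ + b₃ with he
  have he0 : 0 ≤ e := by positivity
  -- Telescoping: exchange the factors one at a time, each of the others being at most `r`.
  have key : ∀ m ≤ n, ‖D m‖ ≤ r ^ m ∧
      r * ‖D m - ∏ i ∈ Finset.range m, localFactor s q i‖ ≤ m * (60 * e) * r ^ m := by
    intro m
    induction m with
    | zero => simp [h.zero]
    | succ m ih =>
      intro hm
      obtain ⟨h1, h2⟩ := ih (by omega)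
      have h0 := (h.growth (m := m) (by omega)).1
      have eD : D (m + 1) = D m * (D (m + 1) / D m) := by field_simp
      constructor
      · rw [eD, norm_mul, pow_succ]
        exact mul_le_mul h1 (h.norm_ratio_le hm) (norm_nonneg _) (by positivity)
      · have e2 : D (m + 1) - ∏ i ∈ Finset.range (m + 1), localFactor s q i =
            localFactor s q m * (D m - ∏ i ∈ Finset.range m, localFactor s q i) +
              D m * (D (m + 1) / D m - localFactor s q m) := by
          rw [Finset.prod_range_succ]
          linear_combination eD
        rw [e2]
        have h3 := norm_add_le (localFactor s q m *
          (D m - ∏ i ∈ Finset.range m, localFactor s q i))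
          (D m * (D (m + 1) / D m - localFactor s q m))
        rw [norm_mul, norm_mul] at h3
        have h4 := mul_le_mul (h.norm_localFactor_le m) h2 (by positivity) hr0.le
        have h5 := mul_le_mul h1 (h.norm_ratio_sub_localFactor_le hm) (norm_nonneg _)
          (by positivity)
        have h6 := mul_le_mul_of_nonneg_left h3 hr0.le
        have h7 := mul_le_mul_of_nonneg_left h5 hr0.le
        push_cast
        rw [pow_succ]
        nlinarith
  have h1 := (key n le_rfl).2
  have h2 : 19 / 20 ≤ r := by
    have := Real.add_one_le_exp (-(P / 20))
    linarith [h.P_le]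
  have h3 : 0 ≤ n * e * r ^ n := by positivity
  nlinarith [norm_nonneg (D n - ∏ i ∈ Finset.range n, localFactor s q i)]

end RunExpansion

theorem prod_localFactor (s q : ℂ) {n : ℕ} (hn : 1 ≤ n) :
    ∏ m ∈ Finset.range n, localFactor s q m =
      Complex.exp (n * s) * Complex.exp (-(n / 2) * s ^ 2 + (n - 1) * (q - s ^ 2)) := by
  obtain ⟨n, rfl⟩ := Nat.exists_eq_add_of_le' hn
  rw [Finset.prod_range_succ', localFactor, if_pos rfl]
  simp only [localFactor, Nat.succ_ne_zero, if_false, Finset.prod_const, Finset.card_range]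
  rw [← Complex.exp_nat_mul, ← Complex.exp_add, ← Complex.exp_add]
  congr 1
  push_cast
  ring

/-! ### Moments of runs of 1-dependent vectors -/

section Runs

variable {𝕜 : Type*} [RCLike 𝕜] {k : ℕ}

/-- The function on `ℤ^k` with value `w r` at `e_r` and value `0` off the coordinate vectors. -/
def coordValue (w : Fin k → 𝕜) (x : Fin k → ℤ) : 𝕜 :=
  ∑ r, if x = coordVec r then w r else 0

theorem coordVec_injective : Function.Injective (coordVec : Fin k → Fin k → ℤ) := by
  intro r j h
  by_contra hne
  have := congr_fun h r
  simp [coordVec, hne] at this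

theorem coordValue_coordVec (w : Fin k → 𝕜) (r : Fin k) : coordValue w (coordVec r) = w r := by
  simp [coordValue, coordVec_injective.eq_iff]

theorem coordValue_of_ne (w : Fin k → 𝕜) {x : Fin k → ℤ} (hx : ∀ r, x ≠ coordVec r) :
    coordValue w x = 0 := by
  simp [coordValue, hx]

theorem coordValue_zero (w : Fin k → 𝕜) : coordValue w 0 = 0 := by
  refine coordValue_of_ne w fun r h => ?_
  have := congr_fun h r
  simp [coordVec] at this

theorem norm_coordValue (w : Fin k → 𝕜) (x : Fin k → ℤ) :
    ‖coordValue w x‖ = coordValue (fun r => ‖w r‖) x := by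
  by_cases h : ∃ r, x = coordVec r
  · obtain ⟨r, rfl⟩ := h
    simp [coordValue_coordVec]
  · push Not at h
    simp [coordValue_of_ne _ h]

theorem norm_coordValue_le {w : Fin k → 𝕜} (hw : ∀ r, ‖w r‖ ≤ 2) (x : Fin k → ℤ) :
    ‖coordValue w x‖ ≤ 2 := by
  by_cases h : ∃ r, x = coordVec r
  · obtain ⟨r, rfl⟩ := h
    simpa [coordValue_coordVec] using hw r
  · push Not at h
    simp [coordValue_of_ne _ h]

variable {Ω : Type*} [MeasurableSpace Ω] {μ : Measure Ω} {X : ℕ → Ω → Fin k → ℤ} {n : ℕ}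

theorem measurable_prod_comp {S : Finset ℕ} (hX : ∀ i ∈ S, Measurable (X i))
    (f : ℕ → (Fin k → ℤ) → 𝕜) : Measurable fun ω => ∏ i ∈ S, f i (X i ω) :=
  Finset.measurable_prod _ fun i hi => (measurable_of_countable (f i)).comp (hX i hi)

theorem integrable_prod_comp [IsProbabilityMeasure μ] {S : Finset ℕ}
    (hX : ∀ i ∈ S, Measurable (X i)) {f : ℕ → (Fin k → ℤ) → 𝕜} {B : ℝ}
    (hf : ∀ i x, ‖f i x‖ ≤ B) : Integrable (fun ω => ∏ i ∈ S, f i (X i ω)) μ := by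
  refine Integrable.of_bound (measurable_prod_comp hX f).aestronglyMeasurable (B ^ S.card) ?_
  refine Filter.Eventually.of_forall fun ω => ?_
  rw [norm_prod]
  rw [← Finset.prod_const]
  exact Finset.prod_le_prod (fun _ _ => norm_nonneg _) fun i _ => hf i _

/-- Products over index sets separated by a gap of at least one index factorize. -/
theorem OneDependent.integral_mul [IsProbabilityMeasure μ] (hdep : OneDependent μ X n)
    (hX : ∀ i < n, Measurable (X i)) {S T : Finset ℕ} (hST : ∀ i ∈ S, ∀ j ∈ T, i + 1 < j)
    (hS : ∀ i ∈ S, i < n) (hT : ∀ j ∈ T, j < n) (f g : ℕ → (Fin k → ℤ) → 𝕜) :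
    ∫ ω, (∏ i ∈ S, f i (X i ω)) * ∏ j ∈ T, g j (X j ω) ∂μ =
      (∫ ω, ∏ i ∈ S, f i (X i ω) ∂μ) * ∫ ω, ∏ j ∈ T, g j (X j ω) ∂μ := by
  rcases S.eq_empty_or_nonempty with rfl | hS0
  · simp
  rcases T.eq_empty_or_nonempty with rfl | hT0
  · simp
  have hind := hdep (S.max' hS0) (T.min' hT0) (T.max' hT0)
    (hST _ (S.max'_mem hS0) _ (T.min'_mem hT0)) (T.min'_le_max' hT0) (hT _ (T.max'_mem hT0))
  have hfm : Measurable[sigmaGen X 0 (S.max' hS0)] fun ω => ∏ i ∈ S, f i (X i ω) := by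
    refine @measurable_prod_comp 𝕜 _ k Ω (sigmaGen X 0 (S.max' hS0)) X S (fun i hi => ?_) f
    exact measurable_iff_comap_le.mpr (le_iSup₂_of_le i ⟨Nat.zero_le _, S.le_max' i hi⟩ le_rfl)
  have hgm : Measurable[sigmaGen X (T.min' hT0) (T.max' hT0)] fun ω => ∏ j ∈ T, g j (X j ω) := by
    refine @measurable_prod_comp 𝕜 _ k Ω (sigmaGen X (T.min' hT0) (T.max' hT0)) X T
      (fun i hi => ?_) g
    exact measurable_iff_comap_le.mpr (le_iSup₂_of_le i ⟨T.min'_le i hi, T.le_max' i hi⟩ le_rfl)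
  have hI : IndepFun (fun ω => ∏ i ∈ S, f i (X i ω)) (fun ω => ∏ j ∈ T, g j (X j ω)) μ := by
    rw [IndepFun_iff_Indep]
    exact indep_of_indep_of_le_left (indep_of_indep_of_le_right hind hgm.comap_le) hfm.comap_le
  exact hI.integral_fun_mul_eq_mul_integral
    (measurable_prod_comp (fun i hi => hX i (hS i hi)) f).aestronglyMeasurable
    (measurable_prod_comp (fun i hi => hX i (hT i hi)) g).aestronglyMeasurable

theorem integral_ite_const [IsProbabilityMeasure μ] {A : Ω → Prop} [DecidablePred A]
    (hA : MeasurableSet {ω | A ω}) (c : 𝕜) :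
    ∫ ω, (if A ω then c else 0) ∂μ = μ.real {ω | A ω} • c := by
  rw [← integral_indicator_const c hA]
  congr 1
  ext ω
  simp [Set.indicator]

theorem integrable_ite_const [IsProbabilityMeasure μ] {A : Ω → Prop} [DecidablePred A]
    (hA : MeasurableSet {ω | A ω}) (c : 𝕜) : Integrable (fun ω => if A ω then c else 0) μ := by
  refine ((integrable_const c).indicator hA).congr (Filter.Eventually.of_forall fun ω => ?_)
  simp [Set.indicator]

theorem measurableSet_eq_coordVec {Y : Ω → Fin k → ℤ} (hY : Measurable Y) (r : Fin k) :
    MeasurableSet {ω | Y ω = coordVec r} :=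
  hY (MeasurableSet.of_discrete (s := {coordVec r}))

theorem integral_coordValue [IsProbabilityMeasure μ] (h0 : Measurable (X 0)) (w : Fin k → 𝕜) :
    ∫ ω, coordValue w (X 0 ω) ∂μ = ∑ r, prob1 μ X r • w r := by
  simp only [coordValue]
  rw [integral_finsetSum _ fun r _ => integrable_ite_const (measurableSet_eq_coordVec h0 r) _]
  exact Finset.sum_congr rfl fun r _ => integral_ite_const (measurableSet_eq_coordVec h0 r) _

theorem integral_coordValue_mul [IsProbabilityMeasure μ] (h0 : Measurable (X 0))
    (h1 : Measurable (X 1)) (w : Fin k → 𝕜) :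
    ∫ ω, coordValue w (X 0 ω) * coordValue w (X 1 ω) ∂μ =
      ∑ r, ∑ j, prob2 μ X r j • (w r * w j) := by
  have hm : ∀ r j, MeasurableSet {ω | X 0 ω = coordVec r ∧ X 1 ω = coordVec j} := fun r j =>
    (measurableSet_eq_coordVec h0 r).inter (measurableSet_eq_coordVec h1 j)
  have e : ∀ ω, coordValue w (X 0 ω) * coordValue w (X 1 ω) =
      ∑ r, ∑ j, if X 0 ω = coordVec r ∧ X 1 ω = coordVec j then w r * w j else 0 := fun ω => by
    simp only [coordValue, Finset.sum_mul_sum]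
    refine Finset.sum_congr rfl fun r _ => Finset.sum_congr rfl fun j _ => ?_
    split_ifs <;> simp_all
  simp only [e]
  rw [integral_finsetSum _ fun r _ => integrable_finsetSum _ fun j _ =>
    integrable_ite_const (hm r j) _]
  refine Finset.sum_congr rfl fun r _ => ?_
  rw [integral_finsetSum _ fun j _ => integrable_ite_const (hm r j) _]
  exact Finset.sum_congr rfl fun j _ => integral_ite_const (hm r j) _

theorem integral_coordValue_mul_mul [IsProbabilityMeasure μ] (h0 : Measurable (X 0))
    (h1 : Measurable (X 1)) (h2 : Measurable (X 2)) (w : Fin k → 𝕜) :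
    ∫ ω, coordValue w (X 0 ω) * coordValue w (X 1 ω) * coordValue w (X 2 ω) ∂μ =
      ∑ r, ∑ j, ∑ m, prob3 μ X r j m • (w r * w j * w m) := by
  have hm : ∀ r j m, MeasurableSet
      {ω | X 0 ω = coordVec r ∧ X 1 ω = coordVec j ∧ X 2 ω = coordVec m} := fun r j m =>
    (measurableSet_eq_coordVec h0 r).inter
      ((measurableSet_eq_coordVec h1 j).inter (measurableSet_eq_coordVec h2 m))
  have e : ∀ ω, coordValue w (X 0 ω) * coordValue w (X 1 ω) * coordValue w (X 2 ω) =
      ∑ r, ∑ j, ∑ m, if X 0 ω = coordVec r ∧ X 1 ω = coordVec j ∧ X 2 ω = coordVec m then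
        w r * w j * w m else 0 := fun ω => by
    simp only [coordValue]
    rw [Finset.sum_mul_sum, Finset.sum_mul]
    refine Finset.sum_congr rfl fun r _ => ?_
    rw [Finset.sum_mul]
    refine Finset.sum_congr rfl fun j _ => ?_
    rw [Finset.mul_sum]
    refine Finset.sum_congr rfl fun m _ => ?_
    split_ifs <;> simp_all
  simp only [e]
  rw [integral_finsetSum _ fun r _ => integrable_finsetSum _ fun j _ =>
    integrable_finsetSum _ fun m _ => integrable_ite_const (hm r j m) _]
  refine Finset.sum_congr rfl fun r _ => ?_
  rw [integral_finsetSum _ fun j _ =>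
    integrable_finsetSum _ fun m _ => integrable_ite_const (hm r j m) _]
  refine Finset.sum_congr rfl fun j _ => ?_
  rw [integral_finsetSum _ fun m _ => integrable_ite_const (hm r j m) _]
  exact Finset.sum_congr rfl fun m _ => integral_ite_const (hm r j m) _

/-- `E ∏_{j ≤ i < c} w(X_i)`. -/
noncomputable def runMoment (μ : Measure Ω) (X : ℕ → Ω → Fin k → ℤ) (w : Fin k → 𝕜) (j c : ℕ) : 𝕜 :=
  ∫ ω, ∏ i ∈ Finset.Ico j c, coordValue w (X i ω) ∂μ

theorem runMoment_one [IsProbabilityMeasure μ] (hX : ∀ i < n, Measurable (X i))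
    (hid : ∀ i < n, IdentDistrib (X i) (X 0) μ μ) (w : Fin k → 𝕜) {j : ℕ} (hj : j < n) :
    runMoment μ X w j (j + 1) = ∑ r, prob1 μ X r • w r := by
  rw [← integral_coordValue (hX 0 (by omega))]
  have := ((hid j hj).comp (measurable_of_countable (coordValue w))).integral_eq
  simpa [runMoment] using this

theorem runMoment_two [IsProbabilityMeasure μ] (hX : ∀ i < n, Measurable (X i))
    (hid : ∀ i, i + 1 < n → IdentDistrib (fun ω => (X i ω, X (i + 1) ω))
      (fun ω => (X 0 ω, X 1 ω)) μ μ) (w : Fin k → 𝕜) {j : ℕ} (hj : j + 1 < n) :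
    runMoment μ X w j (j + 2) = ∑ r, ∑ m, prob2 μ X r m • (w r * w m) := by
  rw [← integral_coordValue_mul (hX 0 (by omega)) (hX 1 (by omega))]
  have := ((hid j hj).comp (measurable_of_countable
    (fun x : (Fin k → ℤ) × (Fin k → ℤ) => coordValue w x.1 * coordValue w x.2))).integral_eq
  simpa [runMoment, Finset.prod_Ico_succ_top] using this

theorem runMoment_three [IsProbabilityMeasure μ] (hX : ∀ i < n, Measurable (X i))
    (hid : ∀ i, i + 2 < n → IdentDistrib (fun ω => (X i ω, X (i + 1) ω, X (i + 2) ω))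
      (fun ω => (X 0 ω, X 1 ω, X 2 ω)) μ μ) (w : Fin k → 𝕜) {j : ℕ} (hj : j + 2 < n) :
    runMoment μ X w j (j + 3) = ∑ r, ∑ m, ∑ l, prob3 μ X r m l • (w r * w m * w l) := by
  rw [← integral_coordValue_mul_mul (hX 0 (by omega)) (hX 1 (by omega)) (hX 2 (by omega))]
  have := ((hid j hj).comp (measurable_of_countable
    (fun x : (Fin k → ℤ) × (Fin k → ℤ) × (Fin k → ℤ) =>
      coordValue w x.1 * coordValue w x.2.1 * coordValue w x.2.2))).integral_eq
  simpa [runMoment, Finset.prod_Ico_succ_top] using this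

theorem norm_runMoment_le (w : Fin k → 𝕜) (j c : ℕ) :
    ‖runMoment μ X w j c‖ ≤ runMoment μ X (fun r => ‖w r‖) j c := by
  refine (norm_integral_le_integral_norm _).trans (le_of_eq ?_)
  simp only [norm_prod, norm_coordValue]
  rfl

/-- Lengthening a run of nonnegative values by two variables costs a factor
`2 · E w(X) ≤ 1 / 36`: the last but one variable is bounded by `2`, and after its removal the last
one is independent of the run. -/
theorem runMoment_add_le [IsProbabilityMeasure μ] (hdep : OneDependent μ X n)
    (hX : ∀ i < n, Measurable (X i)) (hid : ∀ i < n, IdentDistrib (X i) (X 0) μ μ)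
    {w : Fin k → ℝ} (hw0 : ∀ r, 0 ≤ w r) (hw2 : ∀ r, w r ≤ 2)
    (hb : ∑ r, prob1 μ X r * w r ≤ 1 / 72) {j c : ℕ} (hjc : j ≤ c) (v : ℕ) (hv : c + v ≤ n) :
    runMoment μ X w j (c + v) ≤ 12 * runMoment μ X w j c * (1 / 6) ^ v := by
  have h0 : ∀ x, 0 ≤ coordValue w x := fun x =>
    Finset.sum_nonneg fun r _ => by split_ifs <;> simp [hw0]
  have hn2 : ∀ x, ‖coordValue w x‖ ≤ 2 :=
    norm_coordValue_le fun r => by rw [Real.norm_of_nonneg (hw0 r)]; exact hw2 r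
  have h2 : ∀ x, coordValue w x ≤ 2 := fun x => (Real.le_norm_self _).trans (hn2 x)
  have hp : ∀ j c ω, 0 ≤ ∏ i ∈ Finset.Ico j c, coordValue w (X i ω) := fun j c ω =>
    Finset.prod_nonneg fun i _ => h0 _
  have hM : ∀ j c, 0 ≤ runMoment μ X w j c := fun j c => integral_nonneg fun ω => hp j c ω
  have hint : ∀ j c, c ≤ n →
      Integrable (fun ω => ∏ i ∈ Finset.Ico j c, coordValue w (X i ω)) μ := fun j c hc =>
    integrable_prod_comp (fun i hi => hX i (by have := Finset.mem_Ico.mp hi; omega))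
      (f := fun _ => coordValue w) fun _ x => hn2 x
  induction v using Nat.twoStepInduction with
  | zero => simpa using by linarith [hM j c]
  | one =>
    have : runMoment μ X w j (c + 1) ≤ runMoment μ X w j c * 2 := by
      rw [runMoment, runMoment, ← integral_mul_const]
      refine integral_mono (hint _ _ hv) ((hint _ _ (by omega)).mul_const _) fun ω => ?_
      simp only [Finset.prod_Ico_succ_top hjc]
      exact mul_le_mul_of_nonneg_left (h2 _) (hp _ _ _)
    linarith
  | more v ih _ =>
    have ih := ih (by omega)
    have hstep : runMoment μ X w j (c + (v + 2)) ≤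
        2 * (runMoment μ X w j (c + v) * runMoment μ X w (c + v + 1) (c + v + 1 + 1)) := by
      have hI := hdep.integral_mul hX (S := Finset.Ico j (c + v))
        (T := Finset.Ico (c + v + 1) (c + v + 1 + 1))
        (fun i hi l hl => by have := Finset.mem_Ico.mp hi; have := Finset.mem_Ico.mp hl; omega)
        (fun i hi => by have := Finset.mem_Ico.mp hi; omega)
        (fun i hi => by have := Finset.mem_Ico.mp hi; omega)
        (fun _ => coordValue w) (fun _ => coordValue w)
      rw [runMoment, runMoment, runMoment, ← hI, ← integral_const_mul]
      refine integral_mono (hint _ _ hv) (Integrable.const_mul ?_ _) fun ω => ?_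
      · refine Integrable.mul_bdd (c := 2) (hint _ _ (by omega)) (hint _ _ (by omega)).1
          (Filter.Eventually.of_forall fun ω => ?_)
        simpa using hn2 _
      · simp only [← add_assoc, Nat.Ico_succ_singleton, Finset.prod_singleton,
          Finset.prod_Ico_succ_top (show j ≤ c + v + 1 by omega),
          Finset.prod_Ico_succ_top (show j ≤ c + v by omega)]
        have := mul_le_mul_of_nonneg_left (h2 (X (c + v) ω)) (hp j (c + v) ω)
        have := mul_le_mul_of_nonneg_right this (h0 (X (c + v + 1) ω))
        linarith
    rw [runMoment_one hX hid w (by omega)] at hstep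
    simp only [smul_eq_mul] at hstep
    have := mul_le_mul_of_nonneg_left hb (hM j (c + v))
    rw [pow_add]
    linarith

/-- Expanding `∏_{i < m + 1} (1 + Y_i)` according to the run of indices ending at `m`. -/
theorem integral_prod_one_add_succ [IsProbabilityMeasure μ] (hdep : OneDependent μ X n)
    (hX : ∀ i < n, Measurable (X i)) {w : Fin k → 𝕜} (hw2 : ∀ r, ‖w r‖ ≤ 2) {m : ℕ}
    (hm : m < n) :
    ∫ ω, ∏ i ∈ Finset.range (m + 1), (1 + coordValue w (X i ω)) ∂μ =
      (∫ ω, ∏ i ∈ Finset.range m, (1 + coordValue w (X i ω)) ∂μ) +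
        ∑ i ∈ Finset.range (m + 1), runMoment μ X w (m - i) (m + 1) *
          ∫ ω, ∏ l ∈ Finset.range (m - i - 1), (1 + coordValue w (X l ω)) ∂μ := by
  set D : ℕ → 𝕜 := fun m => ∫ ω, ∏ i ∈ Finset.range m, (1 + coordValue w (X i ω)) ∂μ with hD
  have hn2 := norm_coordValue_le hw2
  have hn3 : ∀ x, ‖1 + coordValue w x‖ ≤ 3 := fun x => by
    refine (norm_add_le _ _).trans ?_
    rw [norm_one]
    linarith [hn2 x]
  have hm2 : ∀ j, Integrable (fun ω => ∏ i ∈ Finset.Ico j (m + 1), coordValue w (X i ω)) μ :=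
    fun j => integrable_prod_comp (fun i hi => hX i (by have := Finset.mem_Ico.mp hi; omega))
      (f := fun _ => coordValue w) fun _ x => hn2 x
  have hm3 : ∀ c ≤ n, Integrable (fun ω => ∏ i ∈ Finset.range c, (1 + coordValue w (X i ω))) μ :=
    fun c hc => integrable_prod_comp (fun i hi => hX i (by have := Finset.mem_range.mp hi; omega))
      (f := fun _ x => 1 + coordValue w x) fun _ x => hn3 x
  have hint : ∀ c j, c ≤ n → Integrable (fun ω =>
      (∏ i ∈ Finset.range c, (1 + coordValue w (X i ω))) *
        ∏ i ∈ Finset.Ico j (m + 1), coordValue w (X i ω)) μ := fun c j hc => by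
    refine Integrable.mul_bdd (c := 2 ^ (Finset.Ico j (m + 1)).card) (hm3 c hc) (hm2 j).1
      (Filter.Eventually.of_forall fun ω => ?_)
    rw [norm_prod]
    rw [← Finset.prod_const]
    exact Finset.prod_le_prod (fun _ _ => norm_nonneg _) fun i _ => hn2 _
  have key : ∀ c ≤ m, ∫ ω, (∏ i ∈ Finset.range c, (1 + coordValue w (X i ω))) *
      ∏ i ∈ Finset.Ico c (m + 1), coordValue w (X i ω) ∂μ =
      ∑ j ∈ Finset.range (c + 1), runMoment μ X w j (m + 1) * D (j - 1) := by
    intro c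
    induction c with
    -- The run reaches the first index; its factor `D (0 - 1) = D 0 = 1`.
    | zero => simp [runMoment, hD]
    | succ c ih =>
      intro hc
      rw [Finset.sum_range_succ, ← ih (by omega), add_tsub_cancel_right, mul_comm, hD, runMoment]
      have hI := hdep.integral_mul hX (S := Finset.range c) (T := Finset.Ico (c + 1) (m + 1))
        (fun i hi l hl => by have := Finset.mem_range.mp hi; have := Finset.mem_Ico.mp hl; omega)
        (fun i hi => by have := Finset.mem_range.mp hi; omega)
        (fun i hi => by have := Finset.mem_Ico.mp hi; omega)
        (fun _ x => 1 + coordValue w x) (fun _ => coordValue w)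
      rw [← hI, ← integral_add (hint _ _ (by omega)) (hint _ _ (by omega))]
      refine integral_congr_ae (Filter.Eventually.of_forall fun ω => ?_)
      simp only
      rw [Finset.prod_range_succ, Finset.prod_eq_prod_Ico_succ_bot (show c < m + 1 by omega)]
      ring
  have h1 : D (m + 1) = D m + ∫ ω, (∏ i ∈ Finset.range m, (1 + coordValue w (X i ω))) *
      ∏ i ∈ Finset.Ico m (m + 1), coordValue w (X i ω) ∂μ := by
    rw [hD, ← integral_add (hm3 m hm.le) (hint _ _ hm.le)]
    refine integral_congr_ae (Filter.Eventually.of_forall fun ω => ?_)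
    simp only
    rw [Finset.prod_range_succ, Nat.Ico_succ_singleton, Finset.prod_singleton]
    ring
  change D (m + 1) = D m + ∑ i ∈ Finset.range (m + 1), runMoment μ X w (m - i) (m + 1) *
    D (m - i - 1)
  rw [h1, key m le_rfl, ← Finset.sum_range_reflect]
  simp only [add_tsub_cancel_right]

end Runs

/-! ### The run expansion of the Fourier transform -/

/-- `e^{i t_j} - 1`. -/
noncomputable def expSubOne {k : ℕ} (t : Fin k → ℝ) (j : Fin k) : ℂ :=
  Complex.exp (Complex.I * t j) - 1

theorem norm_expSubOne_le {k : ℕ} (t : Fin k → ℝ) (j : Fin k) : ‖expSubOne t j‖ ≤ 2 := by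
  refine (norm_sub_le _ _).trans ?_
  rw [mul_comm, Complex.norm_exp_ofReal_mul_I, norm_one]
  norm_num

theorem expSubOne_re {k : ℕ} (t : Fin k → ℝ) (j : Fin k) :
    (expSubOne t j).re = -‖expSubOne t j‖ ^ 2 / 2 := by
  rw [← Complex.normSq_eq_norm_sq, Complex.normSq_apply, expSubOne, mul_comm, Complex.sub_re,
    Complex.sub_im, Complex.exp_ofReal_mul_I_re, Complex.exp_ofReal_mul_I_im]
  simp only [Complex.one_re, Complex.one_im]
  nlinarith [Real.sin_sq_add_cos_sq (t j)]

section Moments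

variable {k : ℕ} {p : Fin k → ℝ} {q : Fin k → Fin k → ℝ} {w : Fin k → ℝ}

theorem sum_le_of_le_div (hp : ∀ j, p j ≤ 1 / (144 * (k : ℝ))) : ∑ j, p j ≤ 1 / 144 := by
  rcases Nat.eq_zero_or_pos k with rfl | hk
  · simp
  · refine (Finset.sum_le_sum fun j _ => hp j).trans (le_of_eq ?_)
    have : (k : ℝ) ≠ 0 := by positivity
    rw [Finset.sum_const, Finset.card_univ, Fintype.card_fin, nsmul_eq_mul]
    field_simp

theorem sum_mul_le_of_le (hp0 : ∀ j, 0 ≤ p j) (hp : ∑ j, p j ≤ 1 / 144) {B : ℝ} (hB : 0 ≤ B)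
    (hw : ∀ j, w j ≤ B) : ∑ j, p j * w j ≤ B / 144 := by
  calc ∑ j, p j * w j ≤ ∑ j, p j * B :=
        Finset.sum_le_sum fun j _ => mul_le_mul_of_nonneg_left (hw j) (hp0 j)
    _ = (∑ j, p j) * B := (Finset.sum_mul _ _ _).symm
    _ ≤ 1 / 144 * B := by gcongr
    _ = _ := by ring

theorem sq_sum_mul_le (hp0 : ∀ j, 0 ≤ p j) (hp : ∑ j, p j ≤ 1 / 144) :
    (∑ j, p j * w j) ^ 2 ≤ (∑ j, p j * w j ^ 2) / 144 := by
  have h := Finset.sum_sq_le_sum_mul_sum_of_sq_le_mul Finset.univ (r := fun j => p j * w j)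
    (f := p) (g := fun j => p j * w j ^ 2) (fun j _ => hp0 j)
    (fun j _ => mul_nonneg (hp0 j) (sq_nonneg _)) (fun j _ => le_of_eq (by ring))
  have h0 : 0 ≤ ∑ j, p j * w j ^ 2 :=
    Finset.sum_nonneg fun j _ => mul_nonneg (hp0 j) (sq_nonneg _)
  nlinarith

/-- By `2 w_r w_j ≤ w_r² + w_j²`. -/
theorem sum_pair_mul_le_sq (hq0 : ∀ r j, 0 ≤ q r j)
    (hq : ∀ j, ∑ m, (q m j + q j m) ≤ p j / 5) :
    ∑ r, ∑ j, q r j * (w r * w j) ≤ (∑ j, p j * w j ^ 2) / 10 := by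
  have h1 : ∑ r, ∑ j, q r j * (w r * w j) ≤
      ∑ r, ∑ j, (q r j * (w r ^ 2 / 2) + q r j * (w j ^ 2 / 2)) := by
    refine Finset.sum_le_sum fun r _ => Finset.sum_le_sum fun j _ => ?_
    rw [← mul_add]
    exact mul_le_mul_of_nonneg_left (by nlinarith [sq_nonneg (w r - w j)]) (hq0 r j)
  refine h1.trans ?_
  have h2 : ∑ r, ∑ j, (q r j * (w r ^ 2 / 2) + q r j * (w j ^ 2 / 2)) =
      ∑ j, (∑ m, (q m j + q j m)) * (w j ^ 2 / 2) := by
    simp only [Finset.sum_add_distrib, Finset.sum_mul, add_mul]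
    rw [Finset.sum_comm (f := fun r j => q r j * (w j ^ 2 / 2)), add_comm]
  rw [h2, Finset.sum_div]
  refine Finset.sum_le_sum fun j _ => ?_
  have := mul_le_mul_of_nonneg_right (hq j) (show 0 ≤ w j ^ 2 / 2 by positivity)
  linarith

theorem sum_pair_mul_le (hq0 : ∀ r j, 0 ≤ q r j) (hp0 : ∀ j, 0 ≤ p j)
    (hq : ∀ j, ∑ m, (q m j + q j m) ≤ p j / 5) (hw0 : ∀ j, 0 ≤ w j) (hw2 : ∀ j, w j ≤ 2) :
    ∑ r, ∑ j, q r j * (w r * w j) ≤ 2 * ∑ j, p j * w j := by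
  rw [Finset.mul_sum]
  refine Finset.sum_le_sum fun r _ => ?_
  have h1 : ∑ j, q r j * (w r * w j) ≤ ∑ j, (q j r + q r j) * (2 * w r) := by
    refine Finset.sum_le_sum fun j _ => ?_
    refine mul_le_mul (by linarith [hq0 j r]) ?_ (mul_nonneg (hw0 r) (hw0 j))
      (add_nonneg (hq0 _ _) (hq0 _ _))
    nlinarith [hw0 r, hw2 j]
  rw [← Finset.sum_mul] at h1
  have h2 := mul_le_mul_of_nonneg_right (hq r) (show 0 ≤ 2 * w r by linarith [hw0 r])
  nlinarith [mul_nonneg (hp0 r) (hw0 r)]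

end Moments

section FourierTransform

variable {k : ℕ} {Ω : Type*} [MeasurableSpace Ω] {μ : Measure Ω} {X : ℕ → Ω → Fin k → ℤ} {n : ℕ}

/-- The probabilities `prob2` and `prob3` may involve vectors beyond the first `n`; those enter
only through their nonnegativity and the assumption on `prob2`, since no run of that length
fits into `n` variables. -/
theorem OneDependent.runExpansion [IsProbabilityMeasure μ]
    (hX : ∀ i < n, Measurable (X i))
    (hid1 : ∀ i < n, IdentDistrib (X i) (X 0) μ μ)
    (hid2 : ∀ i, i + 1 < n → IdentDistrib (fun ω => (X i ω, X (i + 1) ω))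
      (fun ω => (X 0 ω, X 1 ω)) μ μ)
    (hid3 : ∀ i, i + 2 < n → IdentDistrib (fun ω => (X i ω, X (i + 1) ω, X (i + 2) ω))
      (fun ω => (X 0 ω, X 1 ω, X 2 ω)) μ μ)
    (hdep : OneDependent μ X n)
    (hp : ∀ j, prob1 μ X j ≤ 1 / (144 * (k : ℝ)))
    (hq : ∀ j, ∑ m, (prob2 μ X m j + prob2 μ X j m) ≤ prob1 μ X j / 5) (t : Fin k → ℝ) :
    RunExpansion n
      (fun m => ∫ ω, ∏ i ∈ Finset.range m, (1 + coordValue (expSubOne t) (X i ω)) ∂μ)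
      (fun m i => runMoment μ X (expSubOne t) (m - i) (m + 1))
      (∑ r, (prob1 μ X r : ℂ) * expSubOne t r)
      (∑ r, ∑ j, (prob2 μ X r j : ℂ) * (expSubOne t r * expSubOne t j))
      (∑ r, prob1 μ X r * ‖expSubOne t r‖)
      (∑ r, ∑ j, prob2 μ X r j * (‖expSubOne t r‖ * ‖expSubOne t j‖))
      (∑ r, ∑ j, ∑ m, prob3 μ X r j m *
        (‖expSubOne t r‖ * ‖expSubOne t j‖ * ‖expSubOne t m‖))
      (∑ r, prob1 μ X r * ‖expSubOne t r‖ ^ 2) := by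
  have hp0 : ∀ j, 0 ≤ prob1 μ X j := fun j => measureReal_nonneg
  have hq0 : ∀ r j, 0 ≤ prob2 μ X r j := fun r j => measureReal_nonneg
  have h30 : ∀ r j m, 0 ≤ prob3 μ X r j m := fun r j m => measureReal_nonneg
  have hps := sum_le_of_le_div hp
  have hz2 := norm_expSubOne_le t
  have hz0 : ∀ r, 0 ≤ ‖expSubOne t r‖ := fun r => norm_nonneg _
  have hz4 : ∀ r, ‖expSubOne t r‖ ^ 2 ≤ 4 := fun r => by nlinarith [hz0 r, hz2 r]
  have hP := sum_mul_le_of_le (w := fun r => ‖expSubOne t r‖ ^ 2) hp0 hps (by norm_num) hz4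
  have hb1 := sum_mul_le_of_le (w := fun r => ‖expSubOne t r‖) hp0 hps (by norm_num) hz2
  have hb2 := sum_pair_mul_le_sq (w := fun r => ‖expSubOne t r‖) hq0 hq
  have hrun := fun j c v => runMoment_add_le hdep hX hid1 (w := fun r => ‖expSubOne t r‖) hz0 hz2
    (by linarith) (j := j) (c := c) (v := v)
  constructor
  case zero => simp
  case succ => exact fun m hm => integral_prod_one_add_succ hdep hX hz2 hm
  case run_one =>
    intro m hm
    simp only [tsub_zero, runMoment_one hX hid1 _ hm, Complex.real_smul]
  case run_two =>
    intro m hm h1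
    obtain ⟨m, rfl⟩ := Nat.exists_eq_add_of_le' h1
    simp only [add_tsub_cancel_right, add_assoc, Nat.reduceAdd, runMoment_two hX hid2 _ hm,
      Complex.real_smul]
  case run_le_two =>
    intro m hm i hi
    refine (norm_runMoment_le _ _ _).trans ?_
    have h := hrun (m - (i + 2)) (m - (i + 2) + 2) (i + 1) (by omega) (by omega)
    rw [runMoment_two hX hid2 _ (by omega),
      show m - (i + 2) + 2 + (i + 1) = m + 1 by omega] at h
    refine h.trans (le_of_eq ?_)
    simp only [smul_eq_mul]
    ring
  case run_le_three =>
    intro m hm i hi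
    refine (norm_runMoment_le _ _ _).trans ?_
    have h := hrun (m - (i + 2)) (m - (i + 2) + 3) i (by omega) (by omega)
    rw [runMoment_three hX hid3 _ (by omega),
      show m - (i + 2) + 3 + i = m + 1 by omega] at h
    simpa only [smul_eq_mul] using h
  case norm_s =>
    refine (norm_sum_le _ _).trans (le_of_eq (Finset.sum_congr rfl fun r _ => ?_))
    rw [norm_mul, Complex.norm_real, Real.norm_of_nonneg (hp0 r)]
  case norm_q =>
    refine (norm_sum_le _ _).trans (Finset.sum_le_sum fun r _ => ?_)
    refine (norm_sum_le _ _).trans (le_of_eq (Finset.sum_congr rfl fun j _ => ?_))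
    rw [norm_mul, Complex.norm_real, Real.norm_of_nonneg (hq0 r j), norm_mul]
  case re_s =>
    rw [Complex.re_sum, ← Finset.sum_neg_distrib, Finset.sum_div]
    refine Finset.sum_congr rfl fun r _ => ?_
    rw [Complex.re_ofReal_mul, expSubOne_re]
    ring
  case b₃_nonneg =>
    exact Finset.sum_nonneg fun r _ => Finset.sum_nonneg fun j _ => Finset.sum_nonneg fun m _ =>
      mul_nonneg (h30 r j m) (by positivity)
  case b₁_sq => exact sq_sum_mul_le hp0 hps
  case b₁_le => linarith
  case P_le => linarith
  case b₂_le_P => exact hb2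
  case b₂_le => linarith
  case b₂_le_b₁ => exact sum_pair_mul_le hq0 hp0 hq hz0 hz2

theorem signedCPFourier_eq_prod (hn : 1 ≤ n) (p : Fin k → ℝ) (q : Fin k → Fin k → ℝ)
    (t : Fin k → ℝ) :
    signedCPFourier n p q t = ∏ m ∈ Finset.range n,
      localFactor (∑ r, (p r : ℂ) * expSubOne t r)
        (∑ r, ∑ j, (q r j : ℂ) * (expSubOne t r * expSubOne t j)) m := by
  have e : ∑ j, ∑ m, ((q j m : ℂ) - p j * p m) * (Complex.exp (Complex.I * t j) - 1) *
      (Complex.exp (Complex.I * t m) - 1) =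
      (∑ r, ∑ j, (q r j : ℂ) * (expSubOne t r * expSubOne t j)) -
        (∑ r, (p r : ℂ) * expSubOne t r) ^ 2 := by
    rw [sq, Finset.sum_mul_sum, ← Finset.sum_sub_distrib]
    refine Finset.sum_congr rfl fun r _ => ?_
    rw [← Finset.sum_sub_distrib]
    refine Finset.sum_congr rfl fun j _ => ?_
    simp only [expSubOne]
    ring
  rw [prod_localFactor _ _ hn, signedCPFourier, e]
  rfl

end FourierTransform

/-! ### The Fourier transform of the sum -/

section SumDist

variable {k : ℕ} {Ω : Type*} [MeasurableSpace Ω] {μ : Measure Ω} {X : ℕ → Ω → Fin k → ℤ} {n : ℕ}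

theorem latticeChar_ofAdd (t : Fin k → ℝ) (x : Fin k → ℤ) :
    latticeChar t (Multiplicative.ofAdd x) =
      Complex.exp (Complex.I * ((∑ j, (x j : ℝ) * t j : ℝ) : ℂ)) := rfl

theorem norm_latticeChar (t : Fin k → ℝ) (x : Multiplicative (Fin k → ℤ)) :
    ‖latticeChar t x‖ = 1 := by
  rw [← ofAdd_toAdd x, latticeChar_ofAdd, mul_comm, Complex.norm_exp_ofReal_mul_I]

theorem latticeChar_eq_one_add {t : Fin k → ℝ} {x : Fin k → ℤ}
    (hx : x = 0 ∨ ∃ r, x = coordVec r) :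
    latticeChar t (Multiplicative.ofAdd x) = 1 + coordValue (expSubOne t) x := by
  rcases hx with rfl | ⟨r, rfl⟩
  · simp [coordValue_zero]
  · have : (∑ j, ((coordVec r j : ℤ) : ℂ) * (t j : ℂ)) = t r := by
      simp [coordVec, Pi.single_apply]
    simp [coordValue_coordVec, expSubOne, latticeChar_ofAdd, this]

theorem hasFourierTransform_real_singleton (ν : Measure (Fin k → ℤ)) [IsProbabilityMeasure ν] :
    HasFourierTransform (fun m => ν.real {m})
      (fun t => ∫ x, latticeChar t (Multiplicative.ofAdd x) ∂ν) := by
  have key : ∀ {f : (Fin k → ℤ) → ℂ}, Integrable f ν →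
      HasSum (fun m => (ν.real {m} : ℂ) * f m) (∫ x, f x ∂ν) := fun {f} hf => by
    have h := hasSum_integral_iUnion (μ := ν) (f := f) (s := fun m : Fin k → ℤ => {m})
      (fun m => measurableSet_singleton m)
      (fun i j hij => Set.disjoint_singleton.mpr hij) hf.integrableOn
    rw [Set.iUnion_of_singleton, Measure.restrict_univ] at h
    simpa only [integral_singleton, Complex.real_smul] using h
  refine ⟨?_, fun t => key ?_⟩
  · have h := (key (f := fun _ => 1) (integrable_const _)).summable.norm
    simpa using h
  · exact Integrable.of_bound (measurable_of_countable _).aestronglyMeasurable 1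
      (Filter.Eventually.of_forall fun x => (norm_latticeChar t _).le)

theorem sumDist_hasFourierTransform [IsProbabilityMeasure μ] (hX : ∀ i < n, Measurable (X i))
    (hv : ∀ i < n, ∀ᵐ ω ∂μ, X i ω = 0 ∨ ∃ r, X i ω = coordVec r) :
    HasFourierTransform (sumDist μ X n) (fun t =>
      ∫ ω, ∏ i ∈ Finset.range n, (1 + coordValue (expSubOne t) (X i ω)) ∂μ) := by
  have hS : Measurable fun ω => ∑ i ∈ Finset.range n, X i ω :=
    Finset.measurable_sum _ fun i hi => hX i (Finset.mem_range.mp hi)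
  have := Measure.isProbabilityMeasure_map (μ := μ) hS.aemeasurable
  have h := hasFourierTransform_real_singleton
    (μ.map fun ω => ∑ i ∈ Finset.range n, X i ω)
  have hall : ∀ᵐ ω ∂μ, ∀ i ∈ Finset.range n, X i ω = 0 ∨ ∃ r, X i ω = coordVec r :=
    (Finset.eventually_all _).mpr fun i hi => hv i (Finset.mem_range.mp hi)
  have e : (fun t : Fin k → ℝ =>
      ∫ ω, ∏ i ∈ Finset.range n, (1 + coordValue (expSubOne t) (X i ω)) ∂μ) = fun t =>
      ∫ x, latticeChar t (Multiplicative.ofAdd x)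
        ∂(μ.map fun ω => ∑ i ∈ Finset.range n, X i ω) := by
    funext t
    rw [integral_map hS.aemeasurable (measurable_of_countable _).aestronglyMeasurable]
    refine integral_congr_ae ?_
    filter_upwards [hall] with ω hω
    rw [ofAdd_sum, map_prod]
    exact Finset.prod_congr rfl fun i hi => (latticeChar_eq_one_add (hω i hi)).symm
  rw [e]
  exact h

end SumDist

theorem HasFourierTransform.sub {k : ℕ} {M N : (Fin k → ℤ) → ℝ} {φ ψ : (Fin k → ℝ) → ℂ}
    (hM : HasFourierTransform M φ) (hN : HasFourierTransform N ψ) :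
    HasFourierTransform (fun m => M m - N m) (fun t => φ t - ψ t) := by
  refine ⟨(hM.1.of_abs.sub hN.1.of_abs).abs, fun t => ?_⟩
  simpa [sub_mul] using (hM.2 t).sub (hN.2 t)

/-! ### Fourier inversion and Parseval's identity on the lattice -/

/-- Lebesgue measure on the cube `(-π, π]^k`. -/
noncomputable def cubeMeasure (k : ℕ) : Measure (Fin k → ℝ) :=
  Measure.pi fun _ => volume.restrict (Set.Ioc (-Real.pi) Real.pi)

instance (k : ℕ) : IsFiniteMeasure (cubeMeasure k) := by
  unfold cubeMeasure
  infer_instance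

theorem integral_exp_I_mul_int (m : ℤ) :
    ∫ x in Set.Ioc (-Real.pi) Real.pi, Complex.exp (Complex.I * m * x) =
      if m = 0 then ((2 * Real.pi : ℝ) : ℂ) else 0 := by
  rw [← intervalIntegral.integral_of_le (by linarith [Real.pi_pos])]
  split_ifs with hm
  · subst hm
    simp
    ring
  · have hc : Complex.I * m ≠ 0 := mul_ne_zero Complex.I_ne_zero (Int.cast_ne_zero.mpr hm)
    rw [integral_exp_mul_complex hc]
    -- The two end points differ by the period `2 π m i`.
    have : Complex.exp (Complex.I * m * (Real.pi : ℝ)) =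
        Complex.exp (Complex.I * m * ((-Real.pi : ℝ) : ℂ)) := by
      rw [Complex.exp_eq_exp_iff_exists_int]
      exact ⟨m, by push_cast; ring⟩
    rw [this, sub_self, zero_div]

section Inversion

variable {k : ℕ}

theorem integral_latticeChar (x : Fin k → ℤ) :
    ∫ t, latticeChar t (Multiplicative.ofAdd x) ∂cubeMeasure k =
      if x = 0 then ((2 * Real.pi : ℝ) : ℂ) ^ k else 0 := by
  have e : ∀ t : Fin k → ℝ, latticeChar t (Multiplicative.ofAdd x) =
      ∏ j, Complex.exp (Complex.I * x j * t j) := fun t => by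
    rw [latticeChar_ofAdd, ← Complex.exp_sum]
    push_cast
    rw [Finset.mul_sum]
    simp only [mul_assoc]
  simp only [e, cubeMeasure]
  rw [integral_fintype_prod_eq_prod (fun j (y : ℝ) => Complex.exp (Complex.I * x j * y))]
  simp only [integral_exp_I_mul_int]
  split_ifs with hx
  · simp [hx]
  · obtain ⟨j, hj⟩ := Function.ne_iff.mp hx
    exact Finset.prod_eq_zero (Finset.mem_univ j) (if_neg hj)

theorem continuous_latticeChar (x : Multiplicative (Fin k → ℤ)) :
    Continuous fun t => latticeChar t x := by
  rw [← ofAdd_toAdd x]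
  simp only [latticeChar_ofAdd]
  fun_prop

theorem HasFourierTransform.continuous {M : (Fin k → ℤ) → ℝ} {φ : (Fin k → ℝ) → ℂ}
    (hM : HasFourierTransform M φ) : Continuous φ := by
  have e : φ = fun t => ∑' m, (M m : ℂ) * latticeChar t (Multiplicative.ofAdd m) :=
    funext fun t => (hM.2 t).tsum_eq.symm
  rw [e]
  refine continuous_tsum (fun m => continuous_const.mul (continuous_latticeChar _)) hM.1
    fun m t => ?_
  rw [norm_mul, norm_latticeChar, mul_one, Complex.norm_real, Real.norm_eq_abs]

theorem HasFourierTransform.norm_le {M : (Fin k → ℤ) → ℝ} {φ : (Fin k → ℝ) → ℂ}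
    (hM : HasFourierTransform M φ) (t : Fin k → ℝ) : ‖φ t‖ ≤ ∑' m, |M m| := by
  rw [← (hM.2 t).tsum_eq]
  refine tsum_of_norm_bounded hM.1.hasSum fun m => ?_
  have := norm_latticeChar t (Multiplicative.ofAdd m)
  rw [latticeChar_ofAdd] at this
  rw [norm_mul, this, mul_one, Complex.norm_real, Real.norm_eq_abs]

theorem HasFourierTransform.inversion {M : (Fin k → ℤ) → ℝ} {φ : (Fin k → ℝ) → ℂ}
    (hM : HasFourierTransform M φ) (m : Fin k → ℤ) :
    ∫ t, φ t * latticeChar t (Multiplicative.ofAdd (-m)) ∂cubeMeasure k =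
      ((2 * Real.pi : ℝ) : ℂ) ^ k * M m := by
  have e : ∀ t x, (M x : ℂ) * latticeChar t (Multiplicative.ofAdd x) *
      latticeChar t (Multiplicative.ofAdd (-m)) =
        M x * latticeChar t (Multiplicative.ofAdd (x - m)) := fun t x => by
    rw [mul_assoc, ← map_mul, ← ofAdd_add, sub_eq_add_neg]
  have hc : ∀ x, Continuous fun t =>
      (M x : ℂ) * latticeChar t (Multiplicative.ofAdd (x - m)) := fun x =>
    continuous_const.mul (continuous_latticeChar _)
  have hn : ∀ x t, ‖(M x : ℂ) * latticeChar t (Multiplicative.ofAdd (x - m))‖ = |M x| :=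
    fun x t => by rw [norm_mul, norm_latticeChar, mul_one, Complex.norm_real, Real.norm_eq_abs]
  have h := hasSum_integral_of_summable_integral_norm (μ := cubeMeasure k)
    (F := fun x t => (M x : ℂ) * latticeChar t (Multiplicative.ofAdd (x - m)))
    (fun x => Integrable.of_bound (hc x).aestronglyMeasurable |M x|
      (Filter.Eventually.of_forall fun t => (hn x t).le))
    (by simpa only [hn, integral_const, smul_eq_mul] using hM.1.mul_left _)
  have hφ : ∀ t, ∑' x, (M x : ℂ) * latticeChar t (Multiplicative.ofAdd (x - m)) =
      φ t * latticeChar t (Multiplicative.ofAdd (-m)) := fun t => by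
    simp only [← e]
    exact ((hM.2 t).mul_right _).tsum_eq
  simp only [hφ, integral_const_mul, integral_latticeChar, sub_eq_zero] at h
  refine h.unique ?_
  refine (hasSum_ite_eq m (((2 * Real.pi : ℝ) : ℂ) ^ k * M m)).congr_fun fun x => ?_
  split_ifs with hx
  · rw [hx, mul_comm]
  · rw [mul_zero]

theorem HasFourierTransform.summable_sq {M : (Fin k → ℤ) → ℝ} {φ : (Fin k → ℝ) → ℂ}
    (hM : HasFourierTransform M φ) : Summable fun m => M m ^ 2 := by
  refine Summable.of_nonneg_of_le (fun m => sq_nonneg _) (fun m => ?_)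
    (hM.1.mul_left (∑' m, |M m|))
  rw [← sq_abs, sq]
  exact mul_le_mul_of_nonneg_right (hM.1.le_tsum m fun _ _ => abs_nonneg _) (abs_nonneg _)

/-- `∑ M{m}² (2π)^k` is computed by inverting one of the two factors `M{m}` and summing under the
integral sign. -/
theorem HasFourierTransform.parseval {M : (Fin k → ℤ) → ℝ} {φ : (Fin k → ℝ) → ℂ}
    (hM : HasFourierTransform M φ) :
    ∫ t, φ t * (starRingEnd ℂ) (φ t) ∂cubeMeasure k =
      ((2 * Real.pi : ℝ) : ℂ) ^ k * ((∑' m, M m ^ 2 : ℝ) : ℂ) := by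
  have hconj : ∀ t (m : Fin k → ℤ), (starRingEnd ℂ) (latticeChar t (Multiplicative.ofAdd m)) =
      latticeChar t (Multiplicative.ofAdd (-m)) := fun t m => by
    rw [latticeChar_ofAdd, latticeChar_ofAdd, ← Complex.exp_conj]
    congr 1
    simp
  have hc : ∀ m, Continuous fun t =>
      (M m : ℂ) * (φ t * latticeChar t (Multiplicative.ofAdd (-m))) := fun m =>
    continuous_const.mul (hM.continuous.mul (continuous_latticeChar _))
  have hn : ∀ m t, ‖(M m : ℂ) * (φ t * latticeChar t (Multiplicative.ofAdd (-m)))‖ ≤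
      |M m| * ∑' m, |M m| := fun m t => by
    rw [norm_mul, norm_mul, norm_latticeChar, mul_one, Complex.norm_real, Real.norm_eq_abs]
    exact mul_le_mul_of_nonneg_left (hM.norm_le t) (abs_nonneg _)
  have hint : ∀ m, Integrable (fun t =>
      (M m : ℂ) * (φ t * latticeChar t (Multiplicative.ofAdd (-m)))) (cubeMeasure k) := fun m =>
    Integrable.of_bound (hc m).aestronglyMeasurable _ (Filter.Eventually.of_forall (hn m))
  have h := hasSum_integral_of_summable_integral_norm (μ := cubeMeasure k) hint
    (Summable.of_nonneg_of_le (fun m => integral_nonneg fun t => norm_nonneg _)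
      (fun m => (integral_mono (hint m).norm (integrable_const _) (hn m)).trans
        (le_of_eq (integral_const _)))
      (by simpa only [smul_eq_mul] using (hM.1.mul_right _).mul_left _))
  have hφ : ∀ t, ∑' m, (M m : ℂ) * (φ t * latticeChar t (Multiplicative.ofAdd (-m))) =
      φ t * (starRingEnd ℂ) (φ t) := fun t => by
    have h1 := ((Complex.hasSum_conj'.mpr (hM.2 t)).mul_left (φ t)).tsum_eq
    rw [← h1]
    refine tsum_congr fun m => ?_
    rw [map_mul, Complex.conj_ofReal, ← latticeChar_ofAdd, hconj]
    ring
  simp only [hφ, integral_const_mul, hM.inversion] at h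
  refine h.unique ?_
  have := (Complex.hasSum_ofReal.mpr hM.summable_sq.hasSum).mul_left (((2 * Real.pi : ℝ) : ℂ) ^ k)
  refine this.congr_fun fun m => ?_
  push_cast
  ring

/-- The factor `(2 π)^{-k}` of the inversion formula is at most `1` and is dropped. -/
theorem HasFourierTransform.abs_le_of_bound {M : (Fin k → ℤ) → ℝ} {φ : (Fin k → ℝ) → ℂ}
    (hM : HasFourierTransform M φ) {g : (Fin k → ℝ) → ℝ} (hg : Integrable g (cubeMeasure k))
    (hφ : ∀ t, ‖φ t‖ ≤ g t) (m : Fin k → ℤ) : |M m| ≤ ∫ t, g t ∂cubeMeasure k := by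
  have h := norm_integral_le_of_norm_le (μ := cubeMeasure k) hg
    (f := fun t => φ t * latticeChar t (Multiplicative.ofAdd (-m)))
    (Filter.Eventually.of_forall fun t => by rw [norm_mul, norm_latticeChar, mul_one]; exact hφ t)
  rw [hM.inversion, norm_mul, norm_pow, Complex.norm_real, Complex.norm_real,
    Real.norm_of_nonneg Real.two_pi_pos.le, Real.norm_eq_abs] at h
  refine le_trans (le_mul_of_one_le_left (abs_nonneg _) (one_le_pow₀ ?_)) h
  linarith [Real.pi_gt_three]

theorem HasFourierTransform.tsum_sq_le_of_bound {M : (Fin k → ℤ) → ℝ} {φ : (Fin k → ℝ) → ℂ}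
    (hM : HasFourierTransform M φ) {g : (Fin k → ℝ) → ℝ} (hg : Integrable g (cubeMeasure k))
    (hφ : ∀ t, ‖φ t‖ ^ 2 ≤ g t) : ∑' m, M m ^ 2 ≤ ∫ t, g t ∂cubeMeasure k := by
  have h := norm_integral_le_of_norm_le (μ := cubeMeasure k) hg
    (f := fun t => φ t * (starRingEnd ℂ) (φ t))
    (Filter.Eventually.of_forall fun t => by
      rw [norm_mul, RCLike.norm_conj, ← sq]; exact hφ t)
  have h0 : 0 ≤ ∑' m, M m ^ 2 := tsum_nonneg fun m => sq_nonneg _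
  rw [hM.parseval, norm_mul, norm_pow, Complex.norm_real, Complex.norm_real,
    Real.norm_of_nonneg Real.two_pi_pos.le, Real.norm_of_nonneg h0] at h
  refine le_trans (le_mul_of_one_le_left h0 (one_le_pow₀ ?_)) h
  linarith [Real.pi_gt_three]

end Inversion

/-! ### Gaussian bounds on the cube -/

theorem two_div_pi_mul_abs_le_norm {x : ℝ} (hx : |x| ≤ Real.pi) :
    2 / Real.pi * |x| ≤ ‖Complex.exp (Complex.I * x) - 1‖ := by
  rw [Complex.norm_exp_I_mul_ofReal_sub_one, norm_mul, Real.norm_ofNat, Real.norm_eq_abs]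
  have h := Real.mul_le_sin (x := |x| / 2) (by positivity) (by linarith)
  have h2 : Real.sin (|x| / 2) ≤ |Real.sin (x / 2)| := by
    rcases abs_cases x with ⟨e, -⟩ | ⟨e, -⟩
    · rw [e]
      exact le_abs_self _
    · rw [e, neg_div, Real.sin_neg]
      exact neg_le_abs _
  linarith

theorem integral_exp_neg_le {l : ℝ} (hl : 0 ≤ l) :
    ∫ x in Set.Ioc (-Real.pi) Real.pi,
      Real.exp (-(l / 40 * ‖Complex.exp (Complex.I * x) - 1‖ ^ 2)) ≤ 18 * (max 1 √l)⁻¹ := by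
  have hc : Continuous fun x : ℝ =>
      Real.exp (-(l / 40 * ‖Complex.exp (Complex.I * x) - 1‖ ^ 2)) := by fun_prop
  have hI : IntegrableOn (fun x : ℝ =>
      Real.exp (-(l / 40 * ‖Complex.exp (Complex.I * x) - 1‖ ^ 2)))
      (Set.Ioc (-Real.pi) Real.pi) :=
    (hc.continuousOn.integrableOn_Icc).mono_set Set.Ioc_subset_Icc_self
  have hpi := Real.pi_pos
  have hpi3 := Real.pi_lt_d2
  rcases le_or_gt l 1 with h1 | h1
  · rw [max_eq_left (Real.sqrt_le_one.mpr h1), inv_one, mul_one]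
    calc _ ≤ ∫ x in Set.Ioc (-Real.pi) Real.pi, (1 : ℝ) := by
          refine setIntegral_mono hI (by simp) fun x => ?_
          rw [Real.exp_le_one_iff, neg_nonpos]
          positivity
      _ = 2 * Real.pi := by
        rw [setIntegral_const, smul_eq_mul, mul_one, Measure.real, Real.volume_Ioc,
          ENNReal.toReal_ofReal (by linarith)]
        ring
      _ ≤ 18 := by linarith
  · rw [max_eq_right (Real.one_le_sqrt.mpr h1.le)]
    have hl0 : 0 < l := by linarith
    have hb : 0 < l / (10 * Real.pi ^ 2) := by positivity
    calc _ ≤ ∫ x in Set.Ioc (-Real.pi) Real.pi, Real.exp (-(l / (10 * Real.pi ^ 2)) * x ^ 2) := by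
          refine setIntegral_mono_on hI (integrable_exp_neg_mul_sq hb).integrableOn
            measurableSet_Ioc fun x hx => ?_
          rw [Real.exp_le_exp, neg_mul, neg_le_neg_iff]
          have h2 := two_div_pi_mul_abs_le_norm (abs_le.mpr ⟨hx.1.le, hx.2⟩)
          have h3 : (2 / Real.pi * |x|) ^ 2 ≤ ‖Complex.exp (Complex.I * x) - 1‖ ^ 2 := by gcongr
          calc l / (10 * Real.pi ^ 2) * x ^ 2 = l / 40 * (2 / Real.pi * |x|) ^ 2 := by
                rw [mul_pow, sq_abs]
                field_simp
                ring
            _ ≤ _ := by gcongr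
      _ ≤ ∫ x, Real.exp (-(l / (10 * Real.pi ^ 2)) * x ^ 2) :=
        setIntegral_le_integral (integrable_exp_neg_mul_sq hb)
          (Filter.Eventually.of_forall fun x => (Real.exp_pos _).le)
      _ = √(10 * Real.pi ^ 3 / l) := by
        rw [integral_gaussian]
        congr 1
        field_simp
      _ ≤ √(18 ^ 2 / l) := by
        refine Real.sqrt_le_sqrt (div_le_div_of_nonneg_right ?_ hl)
        have : Real.pi ^ 3 ≤ 3.15 ^ 3 := by gcongr
        linarith
      _ = 18 * (√l)⁻¹ := by
        rw [Real.sqrt_div (by norm_num), Real.sqrt_sq (by norm_num), div_eq_mul_inv]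

theorem le_inv_max_mul_exp {l x : ℝ} (hl : 0 ≤ l) (hx : x ≤ 2) :
    x ≤ 6 * (max 1 √l)⁻¹ * Real.exp (l * x ^ 2 / 120) := by
  rcases le_or_gt l 1 with h1 | h1
  · rw [max_eq_left (Real.sqrt_le_one.mpr h1), inv_one, mul_one]
    have h2 := Real.add_one_le_exp (l * x ^ 2 / 120)
    have : 0 ≤ l * x ^ 2 := by positivity
    linarith
  · rw [max_eq_right (Real.one_le_sqrt.mpr h1.le)]
    have hs : 0 < √l := Real.sqrt_pos.mpr (by linarith)
    have hsq : √l ^ 2 = l := Real.sq_sqrt (by linarith)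
    -- With `y = x √l` the claim is `y ≤ 6 exp (y² / 120)`, and `exp u ≥ 1 + u` suffices.
    rw [mul_right_comm, ← div_eq_mul_inv, le_div_iff₀ hs]
    have h2 := Real.add_one_le_exp (l * x ^ 2 / 120)
    have h3 : l * x ^ 2 = (x * √l) ^ 2 := by rw [mul_pow, hsq, mul_comm]
    rw [h3] at h2 ⊢
    nlinarith [sq_nonneg (x * √l - 10)]

section Assembly

variable {k : ℕ}

/-- The function `∏_j exp (-n p_j |e^{i t_j} - 1|² / 40)`, a periodic substitute for a Gaussian
of variance of order `n p_j` in direction `j`. -/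
noncomputable def cubeGaussian (n : ℕ) (p : Fin k → ℝ) (t : Fin k → ℝ) : ℝ :=
  ∏ j, Real.exp (-(n * p j / 40 * ‖expSubOne t j‖ ^ 2))

theorem cubeGaussian_eq (n : ℕ) (p : Fin k → ℝ) (t : Fin k → ℝ) :
    cubeGaussian n p t = Real.exp (-(n * (∑ j, p j * ‖expSubOne t j‖ ^ 2) / 40)) := by
  rw [cubeGaussian, ← Real.exp_sum, Finset.sum_neg_distrib, Finset.mul_sum, Finset.sum_div]
  congr 2
  exact Finset.sum_congr rfl fun j _ => by ring

theorem cubeGaussian_nonneg (n : ℕ) (p : Fin k → ℝ) (t : Fin k → ℝ) : 0 ≤ cubeGaussian n p t := by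
  rw [cubeGaussian_eq]
  positivity

theorem cubeGaussian_le_one (n : ℕ) {p : Fin k → ℝ} (hp : ∀ j, 0 ≤ p j) (t : Fin k → ℝ) :
    cubeGaussian n p t ≤ 1 := by
  rw [cubeGaussian_eq, Real.exp_le_one_iff, neg_nonpos]
  have := Finset.sum_nonneg fun j (_ : j ∈ Finset.univ) =>
    mul_nonneg (hp j) (sq_nonneg ‖expSubOne t j‖)
  positivity

theorem integrable_cubeGaussian (n : ℕ) {p : Fin k → ℝ} (hp : ∀ j, 0 ≤ p j) :
    Integrable (cubeGaussian n p) (cubeMeasure k) := by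
  have hc : Continuous (cubeGaussian n p) := by
    unfold cubeGaussian expSubOne
    fun_prop
  refine Integrable.of_bound hc.aestronglyMeasurable 1 (Filter.Eventually.of_forall fun t => ?_)
  rw [Real.norm_of_nonneg (cubeGaussian_nonneg n p t)]
  exact cubeGaussian_le_one n hp t

theorem integral_cubeGaussian_le (n : ℕ) {p : Fin k → ℝ} (hp : ∀ j, 0 ≤ p j) :
    ∫ t, cubeGaussian n p t ∂cubeMeasure k ≤ 18 ^ k * ∏ j, (max 1 √(n * p j))⁻¹ := by
  unfold cubeGaussian cubeMeasure expSubOne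
  rw [integral_fintype_prod_eq_prod (fun j (x : ℝ) =>
    Real.exp (-(n * p j / 40 * ‖Complex.exp (Complex.I * x) - 1‖ ^ 2)))]
  calc _ ≤ ∏ j, (18 * (max 1 √(n * p j))⁻¹) :=
        Finset.prod_le_prod (fun j _ => integral_nonneg fun x => (Real.exp_pos _).le)
          fun j _ => integral_exp_neg_le (mul_nonneg (Nat.cast_nonneg n) (hp j))
    _ = _ := by rw [Finset.prod_mul_distrib]; simp

theorem latticeNorm_top_le {M : (Fin k → ℤ) → ℝ} {A : ℝ} (h : ∀ m, |M m| ≤ A) :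
    latticeNorm ∞ M ≤ ENNReal.ofReal A := by
  rw [latticeNorm_top]
  exact iSup_le fun m => ENNReal.ofReal_le_ofReal (h m)

/-- Interpolation between the supremum norm and the Euclidean norm. -/
theorem latticeNorm_ofReal_le {M : (Fin k → ℤ) → ℝ} {A B S α : ℝ} (hα : 2 ≤ α) (hA : 0 ≤ A)
    (hB : 0 ≤ B) (h : ∀ m, |M m| ≤ A) (hs : Summable fun m => M m ^ 2) (hS : ∑' m, M m ^ 2 ≤ S)
    (hABS : A ^ (α - 2) * S ≤ B ^ α) :
    latticeNorm (ENNReal.ofReal α) M ≤ ENNReal.ofReal B := by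
  have hα0 : 0 < α := by linarith
  rw [latticeNorm_ofReal α hα0, one_div, ENNReal.rpow_inv_le_iff hα0,
    ENNReal.ofReal_rpow_of_nonneg hB hα0.le]
  have hpt : ∀ m, ENNReal.ofReal |M m| ^ α ≤ ENNReal.ofReal (A ^ (α - 2) * M m ^ 2) := fun m => by
    rw [ENNReal.ofReal_rpow_of_nonneg (abs_nonneg _) hα0.le]
    refine ENNReal.ofReal_le_ofReal ?_
    calc |M m| ^ α = |M m| ^ (α - 2) * |M m| ^ (2 : ℝ) := by
          rw [← Real.rpow_add_of_nonneg (abs_nonneg _) (by linarith) (by norm_num),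
            sub_add_cancel]
      _ = |M m| ^ (α - 2) * M m ^ 2 := by rw [Real.rpow_two, sq_abs]
      _ ≤ _ := by
        gcongr
        exact h m
  refine (ENNReal.tsum_le_tsum hpt).trans ?_
  rw [← ENNReal.ofReal_tsum_of_nonneg
    (fun m => mul_nonneg (Real.rpow_nonneg hA _) (sq_nonneg _)) (hs.mul_left _), tsum_mul_left]
  exact ENNReal.ofReal_le_ofReal
    ((mul_le_mul_of_nonneg_left hS (Real.rpow_nonneg hA _)).trans hABS)

/-- The two bounds `c K ∏ γ_j⁻¹` on the supremum and `c K² ∏ γ_j⁻¹` on the sum of squares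
interpolate to the exponent `(α - 1) / α` of each `γ_j`; the constant does not depend on `α`
because `1 ≤ c`. -/
theorem interpolation_constants {K c α : ℝ} (hα : 2 ≤ α) (hK : 0 ≤ K) (hc : 1 ≤ c)
    {γ : Fin k → ℝ} (hγ : ∀ j, 0 < γ j) :
    (c * K * ∏ j, (γ j)⁻¹) ^ (α - 2) * (K ^ 2 * (c * ∏ j, (γ j)⁻¹)) ≤
      (c * K * ∏ j, γ j ^ (-((α - 1) / α))) ^ α := by
  have hα0 : 0 < α := by linarith
  have hG : 0 < ∏ j, (γ j)⁻¹ := Finset.prod_pos fun j _ => inv_pos.mpr (hγ j)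
  have e : ∏ j, γ j ^ (-((α - 1) / α)) = (∏ j, (γ j)⁻¹) ^ ((α - 1) / α) := by
    rw [← Real.finsetProd_rpow _ _ fun j _ => (inv_pos.mpr (hγ j)).le]
    exact Finset.prod_congr rfl fun j _ => by
      rw [Real.inv_rpow (hγ j).le, Real.rpow_neg (hγ j).le]
  rw [e]
  set G := ∏ j, (γ j)⁻¹
  have hcK : 0 ≤ c * K := by positivity
  rw [Real.mul_rpow hcK hG.le, Real.mul_rpow hcK (by positivity), ← Real.rpow_mul hG.le,
    div_mul_cancel₀ _ hα0.ne']
  have h1 : (c * K) ^ α = (c * K) ^ (α - 2) * (c * K) ^ 2 := by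
    rw [← Real.rpow_two, ← Real.rpow_add_of_nonneg hcK (by linarith) (by norm_num),
      sub_add_cancel]
  have h2 : G ^ (α - 1) = G ^ (α - 2) * G := by
    rw [← Real.rpow_add_one hG.ne']
    congr 1
    ring
  rw [h1, h2]
  calc _ = ((c * K) ^ (α - 2) * (G ^ (α - 2) * G)) * (c * K ^ 2) := by ring
    _ ≤ ((c * K) ^ (α - 2) * (G ^ (α - 2) * G)) * (c * K) ^ 2 := by
      gcongr
      rw [mul_pow]
      gcongr
      nlinarith
    _ = _ := by ring

/-- A signed measure on `ℤ^k` whose transform is bounded by `K` times a Gaussian factor has small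
norms: the supremum by inversion, the `ℓ²`-norm by Parseval's identity, the others by
interpolation. -/
theorem HasFourierTransform.latticeNorm_le_of_bound {M : (Fin k → ℤ) → ℝ} {φ : (Fin k → ℝ) → ℂ}
    (hM : HasFourierTransform M φ) {n : ℕ} {p : Fin k → ℝ} (hp : ∀ j, 0 ≤ p j) {K : ℝ}
    (hK : 0 ≤ K) (hφ : ∀ t, ‖φ t‖ ≤ K * cubeGaussian n p t) :
    latticeNorm ∞ M ≤ ENNReal.ofReal (18 ^ k * K * ∏ j, (max 1 √(n * p j))⁻¹) ∧
      ∀ α : ℝ, 2 ≤ α → latticeNorm (ENNReal.ofReal α) M ≤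
        ENNReal.ofReal (18 ^ k * K * ∏ j, (max 1 √(n * p j)) ^ (-((α - 1) / α))) := by
  have hint := integrable_cubeGaussian n hp
  have hI := integral_cubeGaussian_le n hp
  have hγ : ∀ j, 0 < max 1 √(n * p j) := fun j => lt_max_of_lt_left one_pos
  have hsup : ∀ m, |M m| ≤ 18 ^ k * K * ∏ j, (max 1 √(n * p j))⁻¹ := fun m => by
    refine (hM.abs_le_of_bound (hint.const_mul K) hφ m).trans ?_
    rw [integral_const_mul]
    nlinarith [mul_le_mul_of_nonneg_left hI hK]
  have hl2 : ∑' m, M m ^ 2 ≤ K ^ 2 * (18 ^ k * ∏ j, (max 1 √(n * p j))⁻¹) := by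
    refine (hM.tsum_sq_le_of_bound (hint.const_mul (K ^ 2)) fun t => ?_).trans ?_
    · have h0 := cubeGaussian_nonneg n p t
      have h1 := cubeGaussian_le_one n hp t
      calc ‖φ t‖ ^ 2 ≤ (K * cubeGaussian n p t) ^ 2 := by
            gcongr
            exact hφ t
        _ = K ^ 2 * (cubeGaussian n p t * cubeGaussian n p t) := by ring
        _ ≤ K ^ 2 * cubeGaussian n p t := by
          gcongr
          exact mul_le_of_le_one_left h0 h1
    · rw [integral_const_mul]
      gcongr
  refine ⟨latticeNorm_top_le hsup, fun α hα => ?_⟩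
  have hA : 0 ≤ 18 ^ k * K * ∏ j, (max 1 √(n * p j))⁻¹ :=
    mul_nonneg (by positivity) (Finset.prod_nonneg fun j _ => (inv_pos.mpr (hγ j)).le)
  have hB : 0 ≤ 18 ^ k * K * ∏ j, (max 1 √(n * p j)) ^ (-((α - 1) / α)) :=
    mul_nonneg (by positivity) (Finset.prod_nonneg fun j _ => Real.rpow_nonneg (hγ j).le _)
  exact latticeNorm_ofReal_le hα hA hB hsup hM.summable_sq hl2
    (interpolation_constants hα hK (one_le_pow₀ (by norm_num)) hγ)

end Assembly

/-! ### The error term -/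

section ErrorTerm

variable {k : ℕ} {Ω : Type*} [MeasurableSpace Ω] {μ : Measure Ω} {X : ℕ → Ω → Fin k → ℤ} {n : ℕ}

theorem eps2_nonneg : 0 ≤ eps2 μ X n := by
  have hγ : ∀ j, 0 ≤ gam μ X n j := fun j => zero_le_one.trans (le_max_left _ _)
  have h1 : ∀ j, 0 ≤ prob1 μ X j := fun j => measureReal_nonneg
  have h2 : ∀ r j, 0 ≤ prob2 μ X r j := fun r j => measureReal_nonneg
  have h3 : ∀ r j m, 0 ≤ prob3 μ X r j m := fun r j m => measureReal_nonneg
  refine Finset.sum_nonneg fun r _ => Finset.sum_nonneg fun j _ => Finset.sum_nonneg fun m _ => ?_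
  have := hγ r
  have := hγ j
  have := hγ m
  have := h1 r
  have := h1 j
  have := h1 m
  have := h2 r j
  have := h3 r j m
  positivity

/-- Half of the exponential decay pays for replacing each factor `|e^{i t_r} - 1|` of the third
order error term by `6 / γ_r`. -/
theorem moments_mul_exp_le (t : Fin k → ℝ) :
    ((∑ r, prob1 μ X r * ‖expSubOne t r‖) ^ 3 +
      (∑ r, prob1 μ X r * ‖expSubOne t r‖) *
        (∑ r, ∑ j, prob2 μ X r j * (‖expSubOne t r‖ * ‖expSubOne t j‖)) +
      ∑ r, ∑ j, ∑ m, prob3 μ X r j m *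
        (‖expSubOne t r‖ * ‖expSubOne t j‖ * ‖expSubOne t m‖)) *
      Real.exp (-((∑ r, prob1 μ X r * ‖expSubOne t r‖ ^ 2) / 20)) ^ n ≤
      216 * eps2 μ X n * cubeGaussian n (prob1 μ X) t := by
  have h1 : ∀ j, 0 ≤ prob1 μ X j := fun j => measureReal_nonneg
  have h2 : ∀ r j, 0 ≤ prob2 μ X r j := fun r j => measureReal_nonneg
  have h3 : ∀ r j m, 0 ≤ prob3 μ X r j m := fun r j m => measureReal_nonneg
  set z : Fin k → ℝ := fun r => ‖expSubOne t r‖ with hz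
  have hz0 : ∀ r, 0 ≤ z r := fun r => norm_nonneg _
  set P := ∑ r, prob1 μ X r * z r ^ 2 with hP
  set E := Real.exp (n * P / 120) with hE
  have hzr : ∀ r, z r ≤ 6 * (gam μ X n r)⁻¹ * E := fun r => by
    refine (le_inv_max_mul_exp (l := n * prob1 μ X r)
      (mul_nonneg (Nat.cast_nonneg n) (h1 r)) (norm_expSubOne_le t r)).trans ?_
    have hγ : 0 < gam μ X n r := lt_max_of_lt_left one_pos
    refine mul_le_mul_of_nonneg_left ?_ (by positivity)
    rw [hE, Real.exp_le_exp]
    have : prob1 μ X r * z r ^ 2 ≤ P := Finset.single_le_sum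
      (f := fun r => prob1 μ X r * z r ^ 2) (fun i _ => mul_nonneg (h1 i) (sq_nonneg _))
      (Finset.mem_univ r)
    have := mul_le_mul_of_nonneg_left this (Nat.cast_nonneg (α := ℝ) n)
    rw [mul_assoc]
    linarith
  have e : (∑ r, prob1 μ X r * z r) ^ 3 +
      (∑ r, prob1 μ X r * z r) * (∑ r, ∑ j, prob2 μ X r j * (z r * z j)) +
      ∑ r, ∑ j, ∑ m, prob3 μ X r j m * (z r * z j * z m) =
      ∑ r, ∑ j, ∑ m, (prob3 μ X r j m + prob2 μ X r j * prob1 μ X m +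
        prob1 μ X r * prob1 μ X j * prob1 μ X m) * (z r * z j * z m) := by
    have ea : (∑ r, prob1 μ X r * z r) ^ 3 =
        ∑ r, ∑ j, ∑ m, prob1 μ X r * prob1 μ X j * prob1 μ X m * (z r * z j * z m) := by
      rw [pow_succ, sq, Finset.sum_mul_sum, Finset.sum_mul]
      refine Finset.sum_congr rfl fun r _ => ?_
      rw [Finset.sum_mul]
      refine Finset.sum_congr rfl fun j _ => ?_
      rw [Finset.mul_sum]
      exact Finset.sum_congr rfl fun m _ => by ring
    have eb : (∑ r, prob1 μ X r * z r) * (∑ r, ∑ j, prob2 μ X r j * (z r * z j)) =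
        ∑ r, ∑ j, ∑ m, prob2 μ X r j * prob1 μ X m * (z r * z j * z m) := by
      rw [mul_comm, Finset.sum_mul]
      refine Finset.sum_congr rfl fun r _ => ?_
      rw [Finset.sum_mul]
      refine Finset.sum_congr rfl fun j _ => ?_
      rw [Finset.mul_sum]
      exact Finset.sum_congr rfl fun m _ => by ring
    rw [ea, eb]
    simp only [← Finset.sum_add_distrib]
    exact Finset.sum_congr rfl fun r _ => Finset.sum_congr rfl fun j _ =>
      Finset.sum_congr rfl fun m _ => by ring
  have hexp : Real.exp (-(P / 20)) ^ n * E ^ 3 = cubeGaussian n (prob1 μ X) t := by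
    rw [cubeGaussian_eq, hE, ← Real.exp_nat_mul, ← Real.exp_nat_mul, ← Real.exp_add]
    congr 1
    push_cast
    ring
  rw [e]
  have hmain : ∑ r, ∑ j, ∑ m, (prob3 μ X r j m + prob2 μ X r j * prob1 μ X m +
        prob1 μ X r * prob1 μ X j * prob1 μ X m) * (z r * z j * z m) ≤
      216 * eps2 μ X n * E ^ 3 := by
    rw [eps2]
    simp only [Finset.mul_sum, Finset.sum_mul]
    refine Finset.sum_le_sum fun r _ => Finset.sum_le_sum fun j _ => Finset.sum_le_sum fun m _ => ?_
    have hc : 0 ≤ prob3 μ X r j m + prob2 μ X r j * prob1 μ X m +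
        prob1 μ X r * prob1 μ X j * prob1 μ X m :=
      add_nonneg (add_nonneg (h3 r j m) (mul_nonneg (h2 r j) (h1 m)))
        (mul_nonneg (mul_nonneg (h1 r) (h1 j)) (h1 m))
    have hzz : z r * z j * z m ≤ (6 * (gam μ X n r)⁻¹ * E) * (6 * (gam μ X n j)⁻¹ * E) *
        (6 * (gam μ X n m)⁻¹ * E) :=
      mul_le_mul (mul_le_mul (hzr r) (hzr j) (hz0 j) ((hz0 r).trans (hzr r))) (hzr m) (hz0 m)
        (mul_nonneg ((hz0 r).trans (hzr r)) ((hz0 j).trans (hzr j)))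
    refine (mul_le_mul_of_nonneg_left hzz hc).trans (le_of_eq ?_)
    rw [div_eq_mul_inv, mul_inv, mul_inv]
    ring
  calc _ ≤ 216 * eps2 μ X n * E ^ 3 * Real.exp (-(P / 20)) ^ n := by gcongr
    _ = _ := by rw [← hexp]; ring

end ErrorTerm

theorem theorem3 (k : ℕ) :
    ∃ (C : ℝ) (C' : ℝ → ℝ), 0 < C ∧ (∀ α, 2 ≤ α → 0 < C' α) ∧
      ∀ (n : ℕ) (_ : 1 ≤ n) (Ω : Type*) [MeasurableSpace Ω] (μ : Measure Ω)
        [IsProbabilityMeasure μ] (X : ℕ → Ω → Fin k → ℤ)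
        (_ : ∀ i < n, Measurable (X i))
        (_ : ∀ i < n, ∀ᵐ ω ∂μ, X i ω = 0 ∨ ∃ r, X i ω = coordVec r)
        (_ : ∀ i < n, IdentDistrib (X i) (X 0) μ μ)
        (_ : ∀ i, i + 1 < n → IdentDistrib (fun ω => (X i ω, X (i + 1) ω))
          (fun ω => (X 0 ω, X 1 ω)) μ μ)
        (_ : ∀ i, i + 2 < n → IdentDistrib (fun ω => (X i ω, X (i + 1) ω, X (i + 2) ω))
          (fun ω => (X 0 ω, X 1 ω, X 2 ω)) μ μ)
        (_ : OneDependent μ X n)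
        (_ : ∀ r, prob1 μ X r ∈ Set.Ioo (0 : ℝ) 1)
        (_ : ∀ j, prob1 μ X j ≤ 1 / (144 * (k : ℝ)))
        (_ : ∀ j, ∑ m, (prob2 μ X m j + prob2 μ X j m) ≤ prob1 μ X j / 5),
        latticeNorm ∞ (fun m => sumDist μ X n m - signedCP n (prob1 μ X) (prob2 μ X) m) ≤
            ENNReal.ofReal (C * n * eps2 μ X n * ∏ j, (gam μ X n j)⁻¹) ∧
          ∀ α : ℝ, 2 ≤ α →
            latticeNorm (ENNReal.ofReal α)
                (fun m => sumDist μ X n m - signedCP n (prob1 μ X) (prob2 μ X) m) ≤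
              ENNReal.ofReal (C' α * n * eps2 μ X n *
                ∏ j, (gam μ X n j) ^ (-((α - 1) / α))) := by
  refine ⟨18 ^ k * 13824, fun _ => 18 ^ k * 13824, by positivity, fun _ _ => by positivity, ?_⟩
  intro n hn Ω _ μ _ X hX hv hid1 hid2 hid3 hdep hp01 hp hq
  have hM := (sumDist_hasFourierTransform hX hv).sub
    (signedCP_hasFourierTransform n (prob1 μ X) (prob2 μ X))
  have h := hM.latticeNorm_le_of_bound (n := n) (p := prob1 μ X) (fun j => (hp01 j).1.le)
    (K := 13824 * n * eps2 μ X n) (mul_nonneg (by positivity) eps2_nonneg) fun t => by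
      have h1 := (hdep.runExpansion hX hid1 hid2 hid3 hp hq t).norm_sub_prod_localFactor_le
      have h2 := mul_le_mul_of_nonneg_left (moments_mul_exp_le (μ := μ) (X := X) (n := n) t)
        (show (0 : ℝ) ≤ 64 * n by positivity)
      rw [signedCPFourier_eq_prod hn]
      refine h1.trans ?_
      rw [mul_assoc]
      refine h2.trans (le_of_eq ?_)
      ring
  simpa only [mul_assoc, gam] using h
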